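/- Setting. There are $k\ge 2$ arms. Pulling arm $i$ in round $t$ yields a reward $X_{i,t}\sim\mathcal N(\mu_i,\sigma_i^2)$ with $\sigma_i>0$, independent over all arms and rounds; the best arm $b$ is unique, i.e. $\mu_b>\mu_i$ for all $i\ne b$. The knowledge gradient (KG) algorithm keeps posterior means $\theta_i$ and variances $\lambda_i^2$, starting from $\theta_i=0$, $\lambda_i^2=\infty$; when arm $i$ is pulled and the reward $x$ is observed, $(\theta_i,\lambda_i^2)$ becomes $\bigl(\tfrac{\lambda_i^{-2}\theta_i+\sigma_i^{-2}x}{\lambda_i^{-2}+\sigma_i^{-2}},(\lambda_i^{-2}+\sigma_i^{-2})^{-1}\bigr)$, the other arms being unchanged. In each round it pulls an arm, chosen as a measurable function of the current $(\theta_i,\lambda_i^2)_{i\le k}$, that maximizes $v_i=\zeta_i f\bigl(-|\theta_i-\max_{j\ne i}\theta_j|/\zeta_i\bigr)$, where $f(x)=x\Phi(x)+\phi(x)$ ($\Phi,\phi$ the standard normal distribution function and density), $\zeta_i^2=\lambda_i^2-(\lambda_i^{-2}+\sigma_i^{-2})^{-1}$, and $v_i=\infty$ for an arm not yet pulled (ties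 broken arbitrarily). After $t$ rounds it recommends an arm $J_t$ with the largest $\theta_i$. Let $e_t=\mathbb P(J_t\ne b)$ and $r_t=\mathbb E[\mu_b-\mu_{J_t}]$. Notation. $\sigma_{\max}=\max_i\sigma_i$, $\sigma_{\min}=\min_i\sigma_i$, $\delta_{\max}=\max_{i_1\ne i_2}|\mu_{i_1}-\mu_{i_2}|$, $\delta_{\min}$ is the smallest positive $|\mu_{i_1}-\mu_{i_2}|$, $\mu_*=\max_{j\ne b}\mu_j$, $L=\max\bigl\{\ln\tfrac{27\delta_{\max}^3}{8\sigma_{\min}^4},0\bigr\}$, $q(s)=4\sigma_{\max}k^{-1/8}s^{-1/8}\exp\bigl\{-\tfrac{k^{1/4}s^{1/4}}{8\sigma_{\max}^2}\bigr\}$, and for $i\ne b$ $$\underline\rho^{(1)}_{i,t}=\frac{\mu_b-\mu_*-(\frac34t)^{-1/4}}{\bigl(1+(\frac{3t}{4k})^{-3/4}\bigr)^2\sigma_b}\Bigl(\frac{(\mu_b-\mu_i+(\frac34t)^{-1/4})^2}{\sigma_i^2}+\frac{16k}{\sqrt{3t}}+\frac{8kL}{3t}\Bigr)^{-1/2},$$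 $$\underline\rho^{(2)}_{i,t}=\frac{\mu_b-\mu_*-t^{-1/4}}{\bigl(1+(\frac tk)^{-3/4}\bigr)\sigma_b}\Bigl(\frac{(\mu_b-\mu_i+t^{-1/4})^2}{\sigma_i^2}+\frac{8k}{\sqrt t}+\frac{2kL}{t}\Bigr)^{-1/2},$$ $$\overline\rho^{(1)}_{i,t}=\frac{\bigl(1+(\frac tk)^{-3/4}\bigr)\sigma_i}{\mu_b-\mu_i-t^{-1/4}}\Bigl(\frac{(\mu_b-\mu_*+t^{-1/4})^2}{\sigma_b^2}+\frac{8k}{\sqrt t}+\frac{2kL}{t}\Bigr)^{1/2},$$ $$\overline\rho^{(2)}_{i,t}=\frac{\bigl(1+(\frac{3t}{4k})^{-3/4}\bigr)^2\sigma_i}{\mu_b-\mu_i-(\frac34t)^{-1/4}}\Bigl(\frac{(\mu_b-\mu_*+(\frac34t)^{-1/4})^2}{\sigma_b^2}+\frac{16k}{\sqrt{3t}}+\frac{8kL}{3t}\Bigr)^{1/2},$$ $\underline\rho_{i,t}=\min\{\underline\rho^{(1)}_{i,t},\underline\rho^{(2)}_{i,t}\}$, $\overline\rho_{i,t}=\max\{\overline\rho^{(1)}_{i,t},\overline\rho^{(2)}_{i,t}\}$,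 $\underline S_t=1+\sum_{i\ne b}\underline\rho_{i,t}$, $\overline S_t=1+\sum_{i\ne b}\overline\rho_{i,t}$, $g_j=\mu_b-\mu_j-\frac{\delta_{\min}}2$. Claim. There is $T$ such that for all $t>T$ $$e_t\ \ge\ B_t:=\frac{[1-q(\frac34t)]^{2k}}{2\pi}\min_{j\ne b}\left\{\frac{\frac{\delta_{\min}}{2\sigma_j}\sqrt{\underline\rho_{j,t}/\overline S_t}}{1+\frac{\delta_{\min}^2\overline\rho_{j,t}t}{4\sigma_j^2\underline S_t}}\cdot\frac{\frac{g_jt}{\sigma_b\sqrt{\overline S_t}}}{1+\frac{g_j^2t}{\sigma_b^2\underline S_t}}\exp\Bigl\{-\frac{\delta_{\min}^2\overline\rho_{j,t}t}{8\sigma_j^2\underline S_t}\Bigr\}\exp\Bigl\{-\frac{g_j^2t}{2\sigma_b^2\underline S_t}\Bigr\}\right\}\quad\text{and}\quad r_t\ \ge\ \delta_{\min}B_t.$$ In particular the decay is at most exponentially fast: there are $c,C>0$ with $e_t\ge ce^{-Ct}$ and $r_t\ge ce^{-Ct}$ for all $t>T$. -/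

import Mathlib

open MeasureTheory ProbabilityTheory
open scoped ENNReal NNReal

namespace KnowledgeGradient

noncomputable section

/-! ### The knowledge gradient algorithm -/

/-- The knowledge `(θ, λ²)`: posterior means and posterior variances of the `k` arms. A variance is
`⊤` for an arm that has not been pulled yet (non-informative prior). -/
abbrev Knowledge (k : ℕ) : Type := (Fin k → ℝ) × (Fin k → ℝ≥0∞)

/-- The non-informative prior: all means are `0`, all variances are infinite. -/
def prior (k : ℕ) : Knowledge k := (fun _ => 0, fun _ => ⊤)

/-- The posterior variance `(λ⁻² + σ⁻²)⁻¹` after one more pull of an arm whose current posterior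
variance is `l` and whose reward standard deviation is `s`. -/
def nextVar (s : ℝ) (l : ℝ≥0∞) : ℝ≥0∞ := (l⁻¹ + (ENNReal.ofReal (s ^ 2))⁻¹)⁻¹

/-- The posterior mean `(λ⁻² θ + σ⁻² x) / (λ⁻² + σ⁻²)` after the reward `x` is observed
(`λ⁻² = 0` if `λ² = ⊤`). -/
def nextMean (s θ : ℝ) (l : ℝ≥0∞) (x : ℝ) : ℝ :=
  (l⁻¹.toReal * θ + (s ^ 2)⁻¹ * x) / (l⁻¹.toReal + (s ^ 2)⁻¹)

/-- Bayesian update of the knowledge when arm `a` is pulled and the reward `x` is observed. -/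
def update {k : ℕ} (σ : Fin k → ℝ) (S : Knowledge k) (a : Fin k) (x : ℝ) : Knowledge k :=
  (Function.update S.1 a (nextMean (σ a) (S.1 a) (S.2 a) x),
   Function.update S.2 a (nextVar (σ a) (S.2 a)))

/-- `f(x) = x Φ(x) + φ(x)`, with `Φ` and `φ` the standard normal distribution function and
density. -/
def f (x : ℝ) : ℝ := x * cdf (gaussianReal 0 1) x + gaussianPDFReal 0 1 x

/-- `max_{j ≠ i} g j`, for `k ≥ 2`. -/
def maxOther {k : ℕ} (g : Fin k → ℝ) (i : Fin k) : ℝ := ⨆ j : {j : Fin k // j ≠ i}, g j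

/-- `ζ_i² = λ_i² - λ_i'²`, with `λ_i'²` the posterior variance after one more pull of arm `i`. -/
def zetaSq {k : ℕ} (σ : Fin k → ℝ) (S : Knowledge k) (i : Fin k) : ℝ≥0∞ :=
  S.2 i - nextVar (σ i) (S.2 i)

/-- The knowledge gradient value `ζ_i f (-|θ_i - max_{j ≠ i} θ_j| / ζ_i)` of arm `i`. It is infinite
for `ζ_i = ∞`, that is, for an arm that has not been pulled yet. -/
def kgValue {k : ℕ} (σ : Fin k → ℝ) (S : Knowledge k) (i : Fin k) : ℝ≥0∞ :=
  if zetaSq σ S i = ⊤ then ⊤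
  else ENNReal.ofReal (Real.sqrt (zetaSq σ S i).toReal *
    f (-|S.1 i - maxOther S.1 i| / Real.sqrt (zetaSq σ S i).toReal))

/-- A KG sampling rule: a (measurable) map from knowledge to arms that always selects a maximizer
of the knowledge gradient value. Ties are broken in an arbitrary way. -/
structure IsKGRule {k : ℕ} (σ : Fin k → ℝ) (rule : Knowledge k → Fin k) : Prop where
  measurable : Measurable rule
  isMax : ∀ (S : Knowledge k) (i : Fin k), kgValue σ S i ≤ kgValue σ S (rule S)

/-- A recommendation rule: a (measurable) map that selects an arm with the largest posterior mean.
Ties are broken in an arbitrary way. -/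
structure IsRecommendation {k : ℕ} (recom : (Fin k → ℝ) → Fin k) : Prop where
  measurable : Measurable recom
  isMax : ∀ (θ : Fin k → ℝ) (i : Fin k), θ i ≤ θ (recom θ)

/-- The knowledge after `t` rounds, when the arms are pulled according to `rule` and `x i s` is the
reward that a pull of arm `i` in round `s = 1, 2, …` yields. -/
def knowledge {k : ℕ} (σ : Fin k → ℝ) (rule : Knowledge k → Fin k) (x : Fin k → ℕ → ℝ) :
    ℕ → Knowledge k
  | 0 => prior k
  | t + 1 =>
    let S := knowledge σ rule x t
    update σ S (rule S) (x (rule S) (t + 1))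

/-- The arm `J_t` recommended after `t` rounds. -/
def recommended {k : ℕ} (σ : Fin k → ℝ) (rule : Knowledge k → Fin k) (recom : (Fin k → ℝ) → Fin k)
    (x : Fin k → ℕ → ℝ) (t : ℕ) : Fin k :=
  recom (knowledge σ rule x t).1

/-- The rewards `X i t` (arm `i`, round `t`) are independent over all arms and rounds and `X i t` is
normal with mean `μ i` and standard deviation `σ i`. -/
structure IsRewardModel {Ω : Type*} [MeasurableSpace Ω] (P : Measure Ω) {k : ℕ} (μ σ : Fin k → ℝ)
    (X : Fin k → ℕ → Ω → ℝ) : Prop where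
  measurable : ∀ i t, Measurable (X i t)
  law : ∀ i t, P.map (X i t) = gaussianReal (μ i) (σ i ^ 2).toNNReal
  indep : iIndepFun (fun p : Fin k × ℕ => X p.1 p.2) P

/-- The probability of error `e_t = P(J_t ≠ b)` after `t` rounds. -/
def probError {Ω : Type*} [MeasurableSpace Ω] (P : Measure Ω) {k : ℕ} (σ : Fin k → ℝ)
    (rule : Knowledge k → Fin k) (recom : (Fin k → ℝ) → Fin k) (X : Fin k → ℕ → Ω → ℝ) (b : Fin k)
    (t : ℕ) : ℝ :=
  P.real {ω | recommended σ rule recom (fun i s => X i s ω) t ≠ b}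

/-- The simple regret `r_t = E[μ_b - μ_{J_t}]` after `t` rounds. -/
def simpleRegret {Ω : Type*} [MeasurableSpace Ω] (P : Measure Ω) {k : ℕ} (μ σ : Fin k → ℝ)
    (rule : Knowledge k → Fin k) (recom : (Fin k → ℝ) → Fin k) (X : Fin k → ℕ → Ω → ℝ) (b : Fin k)
    (t : ℕ) : ℝ :=
  ∫ ω, (μ b - μ (recommended σ rule recom (fun i s => X i s ω) t)) ∂P

/-! ### The quantities in the bounds -/

/-- `σ_max`. -/
def sigmaMax {k : ℕ} (σ : Fin k → ℝ) : ℝ := ⨆ i, σ i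

/-- `σ_min`. -/
def sigmaMin {k : ℕ} (σ : Fin k → ℝ) : ℝ := ⨅ i, σ i

/-- `δ_max = max_{i₁ ≠ i₂} |μ_{i₁} - μ_{i₂}|`. -/
def deltaMax {k : ℕ} (μ : Fin k → ℝ) : ℝ :=
  ⨆ p : {p : Fin k × Fin k // p.1 ≠ p.2}, |μ p.1.1 - μ p.1.2|

/-- `δ_min`, the smallest positive value of `|μ_{i₁} - μ_{i₂}|`. -/
def deltaMin {k : ℕ} (μ : Fin k → ℝ) : ℝ :=
  sInf {d : ℝ | 0 < d ∧ ∃ i₁ i₂ : Fin k, i₁ ≠ i₂ ∧ d = |μ i₁ - μ i₂|}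

/-- `q(s) = 4 σ_max k^{-1/8} s^{-1/8} exp (-k^{1/4} s^{1/4} / (8 σ_max²))`. -/
def q {k : ℕ} (σ : Fin k → ℝ) (s : ℝ) : ℝ :=
  4 * sigmaMax σ * (k : ℝ) ^ (-(1 / 8) : ℝ) * s ^ (-(1 / 8) : ℝ) *
    Real.exp (-((k : ℝ) ^ (1 / 4 : ℝ) * s ^ (1 / 4 : ℝ)) / (8 * sigmaMax σ ^ 2))

/-- `max {ln (27 δ_max³ / (8 σ_min⁴)), 0}`. -/
def logTerm {k : ℕ} (μ σ : Fin k → ℝ) : ℝ :=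
  max (Real.log (27 * deltaMax μ ^ 3 / (8 * sigmaMin σ ^ 4))) 0

/-- The first lower ratio. -/
def rhoLow1 {k : ℕ} (μ σ : Fin k → ℝ) (b i : Fin k) (t : ℝ) : ℝ :=
  (μ b - maxOther μ b - (3 / 4 * t) ^ (-(1 / 4) : ℝ)) /
      ((1 + (3 * t / (4 * k)) ^ (-(3 / 4) : ℝ)) ^ 2 * σ b) *
    ((μ b - μ i + (3 / 4 * t) ^ (-(1 / 4) : ℝ)) ^ 2 / σ i ^ 2 + 16 * k / Real.sqrt (3 * t) +
      8 * k * logTerm μ σ / (3 * t)) ^ (-(1 / 2) : ℝ)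

/-- The second lower ratio. -/
def rhoLow2 {k : ℕ} (μ σ : Fin k → ℝ) (b i : Fin k) (t : ℝ) : ℝ :=
  (μ b - maxOther μ b - t ^ (-(1 / 4) : ℝ)) / ((1 + (t / k) ^ (-(3 / 4) : ℝ)) * σ b) *
    ((μ b - μ i + t ^ (-(1 / 4) : ℝ)) ^ 2 / σ i ^ 2 + 8 * k / Real.sqrt t +
      2 * k * logTerm μ σ / t) ^ (-(1 / 2) : ℝ)

/-- The first upper ratio. -/
def rhoUp1 {k : ℕ} (μ σ : Fin k → ℝ) (b i : Fin k) (t : ℝ) : ℝ :=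
  (1 + (t / k) ^ (-(3 / 4) : ℝ)) * σ i / (μ b - μ i - t ^ (-(1 / 4) : ℝ)) *
    ((μ b - maxOther μ b + t ^ (-(1 / 4) : ℝ)) ^ 2 / σ b ^ 2 + 8 * k / Real.sqrt t +
      2 * k * logTerm μ σ / t) ^ (1 / 2 : ℝ)

/-- The second upper ratio. -/
def rhoUp2 {k : ℕ} (μ σ : Fin k → ℝ) (b i : Fin k) (t : ℝ) : ℝ :=
  (1 + (3 * t / (4 * k)) ^ (-(3 / 4) : ℝ)) ^ 2 * σ i /
      (μ b - μ i - (3 / 4 * t) ^ (-(1 / 4) : ℝ)) *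
    ((μ b - maxOther μ b + (3 / 4 * t) ^ (-(1 / 4) : ℝ)) ^ 2 / σ b ^ 2 +
      16 * k / Real.sqrt (3 * t) + 8 * k * logTerm μ σ / (3 * t)) ^ (1 / 2 : ℝ)

/-- The lower ratio for arm `i` against the best arm `b`. -/
def rhoLow {k : ℕ} (μ σ : Fin k → ℝ) (b i : Fin k) (t : ℝ) : ℝ :=
  min (rhoLow1 μ σ b i t) (rhoLow2 μ σ b i t)

/-- The upper ratio for arm `i` against the best arm `b`. -/
def rhoUp {k : ℕ} (μ σ : Fin k → ℝ) (b i : Fin k) (t : ℝ) : ℝ :=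
  max (rhoUp1 μ σ b i t) (rhoUp2 μ σ b i t)

/-- `1 + ∑_{i ≠ b}` of the lower ratios. -/
def sumLow {k : ℕ} (μ σ : Fin k → ℝ) (b : Fin k) (t : ℝ) : ℝ :=
  1 + ∑ i ∈ Finset.univ.erase b, rhoLow μ σ b i t

/-- `1 + ∑_{i ≠ b}` of the upper ratios. -/
def sumUp {k : ℕ} (μ σ : Fin k → ℝ) (b : Fin k) (t : ℝ) : ℝ :=
  1 + ∑ i ∈ Finset.univ.erase b, rhoUp μ σ b i t

/-- The expression that is minimized over the arms `j ≠ b` in the lower bounds. -/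
def tailProduct {k : ℕ} (μ σ : Fin k → ℝ) (b j : Fin k) (t : ℝ) : ℝ :=
  (deltaMin μ / (2 * σ j) * Real.sqrt (rhoLow μ σ b j t / sumUp μ σ b t)) /
      (1 + deltaMin μ ^ 2 * rhoUp μ σ b j t * t / (4 * σ j ^ 2 * sumLow μ σ b t)) *
    (((μ b - μ j - deltaMin μ / 2) * t / (σ b * Real.sqrt (sumUp μ σ b t))) /
      (1 + (μ b - μ j - deltaMin μ / 2) ^ 2 * t / (σ b ^ 2 * sumLow μ σ b t))) *
    Real.exp (-(deltaMin μ ^ 2 * rhoUp μ σ b j t * t / (8 * σ j ^ 2 * sumLow μ σ b t))) *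
    Real.exp (-((μ b - μ j - deltaMin μ / 2) ^ 2 * t / (2 * σ b ^ 2 * sumLow μ σ b t)))

/-- The lower bound for the probability of error,
`[1 - q(3t/4)]^{2k} / (2π) · min_{j ≠ b} tailProduct`. -/
def peLowerBound {k : ℕ} (μ σ : Fin k → ℝ) (b : Fin k) (t : ℝ) : ℝ :=
  (1 - q σ (3 / 4 * t)) ^ (2 * k) / (2 * Real.pi) *
    ⨅ j : {j : Fin k // j ≠ b}, tailProduct μ σ b j t

end

end KnowledgeGradient

/-! The rate of decay of `peLowerBound` is beaten by a change of measure. If on every path whose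
sample means stay close to shifted means `μ + h` a wrong arm is recommended, then the probability of
error is at least `exp (-V / 2 - 2 √V) / 4`, where `V` bounds the information `∑ n_i h_i² / σ_i²`
that the `n_i` pulls of the arms carry about the shift on these paths (`le_probError`). Under the
shifted means such paths have probability at least `1 / 2`, by the maximal inequality for
exponential martingales of the adaptively observed rewards, and the logarithm of the likelihood
ratio is at most `V / 2 + 2 √V` up to probability `1 / 4`, by Chernoff's bound.

The shift depends on the number of arms. For two arms `b` and `j`, both are moved by
`λ = (μ_b - μ_j) / (σ_b + σ_j)` standard deviations to a common level, plus a separation of order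
`t^{-1/2}`. Each pull then costs `λ² / 2`, whatever the allocation, and `V = λ² t + O(√t)`. As the
algorithm always pulls the arm with the larger `ζ`, both arms receive a positive fraction of the
pulls and the separation is visible in the sample means (`exists_le_probError_of_two`). The exponent
of `peLowerBound` is at least `λ² t / 2`, because `4 σ_b σ_j ≤ (σ_b + σ_j)²`, and for `σ_b = σ_j`
the gain comes from the corrections of relative order `t^{-1/4}` in the ratios, which add a multiple
of `t^{3/4}` (`exists_le_tailExponent_of_two`).

For three or more arms, take the pair of arms `a`, `a'` with the smallest
`λ = |μ_a - μ_a'| / (σ_a + σ_a')`, move both to (almost) the same level and all other arms below it.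
Since the knowledge gradient value decays like a Gaussian tail in the number of pulls times the gap,
the other arms then receive only a small fraction of the pulls, so that moving them is almost free,
and the error decays at most at the rate `λ² / 2` (`exists_le_probError_of_pair`). The choice of the
pair makes the intervals of radius `λ σ_i` around `μ_i` disjoint, and packing them between the
lowest and the second best mean shows that `λ² / 2` is strictly smaller than the rate of the factor
of `peLowerBound` that belongs to the arm with the lowest mean (`exists_rate_lt`). -/

namespace KnowledgeGradient

open Filter Topology

/-! ### The function `f(x) = x Φ(x) + φ(x)` -/

section NormalFunction

open Set

lemma gaussianPDFReal_std (x : ℝ) :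
    gaussianPDFReal 0 1 x = (Real.sqrt (2 * Real.pi))⁻¹ * Real.exp (-(x ^ 2 / 2)) := by
  simp [gaussianPDFReal, neg_div]

lemma gaussianPDFReal_std_le {x y : ℝ} (h : |x| ≤ |y|) :
    gaussianPDFReal 0 1 y ≤ gaussianPDFReal 0 1 x := by
  rw [gaussianPDFReal_std, gaussianPDFReal_std]
  have := sq_le_sq.mpr h
  gcongr

lemma hasDerivAt_neg_gaussianPDFReal_std (x : ℝ) :
    HasDerivAt (fun y => -gaussianPDFReal 0 1 y) (x * gaussianPDFReal 0 1 x) x := by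
  have h0 : (fun y => -gaussianPDFReal 0 1 y) =
      fun y => -((Real.sqrt (2 * Real.pi))⁻¹ * Real.exp (-(y ^ 2 / 2))) := by
    ext y; rw [gaussianPDFReal_std]
  rw [h0, gaussianPDFReal_std]
  have h1 : HasDerivAt (fun y : ℝ => -(y ^ 2 / 2)) (-x) x :=
    ((hasDerivAt_pow 2 x).div_const 2).neg.congr_deriv (by norm_num)
  exact (h1.exp.const_mul (Real.sqrt (2 * Real.pi))⁻¹).neg.congr_deriv (by ring)

lemma integrable_mul_gaussianPDFReal_std :
    Integrable (fun x : ℝ => x * gaussianPDFReal 0 1 x) := by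
  have h := (memLp_id_gaussianReal (μ := 0) (v := 1) 1).integrable le_rfl
  rw [gaussianReal_of_var_ne_zero _ one_ne_zero, gaussianPDF_def,
    integrable_withDensity_iff_integrable_smul'] at h
  · refine h.congr (ae_of_all _ fun x => ?_)
    simp [ENNReal.toReal_ofReal (gaussianPDFReal_nonneg 0 1 x), mul_comm]
  · exact (measurable_gaussianPDFReal 0 1).ennreal_ofReal
  · simp

lemma tendsto_gaussianPDFReal_std_atBot :
    Tendsto (fun x => gaussianPDFReal 0 1 x) atBot (𝓝 0) := by
  have h : (fun x => gaussianPDFReal 0 1 x) =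
      fun x => (Real.sqrt (2 * Real.pi))⁻¹ * Real.exp (-(x ^ 2 / 2)) := by
    ext x; rw [gaussianPDFReal_std]
  rw [h, show (0 : ℝ) = (Real.sqrt (2 * Real.pi))⁻¹ * 0 by simp]
  refine Tendsto.const_mul _ (Real.tendsto_exp_neg_atTop_nhds_zero.comp ?_)
  exact Tendsto.atTop_div_const two_pos
    (((tendsto_pow_atTop two_ne_zero).comp tendsto_abs_atBot_atTop).congr fun x => sq_abs x)

/-- `f(x) = 𝔼 (x - Z)⁺` for a standard normal `Z`. -/
lemma f_eq_integral (x : ℝ) :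
    f x = ∫ z, max (x - z) 0 * gaussianPDFReal 0 1 z := by
  have hφ := integrable_gaussianPDFReal 0 1
  have h1 : ∫ z in Iic x, gaussianPDFReal 0 1 z = cdf (gaussianReal 0 1) x := by
    rw [cdf_eq_real, Measure.real, gaussianReal_apply_eq_integral _ one_ne_zero,
      ENNReal.toReal_ofReal]
    exact setIntegral_nonneg measurableSet_Iic fun z _ => gaussianPDFReal_nonneg 0 1 z
  have h2 : ∫ z in Iic x, z * gaussianPDFReal 0 1 z = -gaussianPDFReal 0 1 x := by
    rw [integral_Iic_of_hasDerivAt_of_tendsto'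
      (fun z _ => hasDerivAt_neg_gaussianPDFReal_std z)
      integrable_mul_gaussianPDFReal_std.integrableOn
      (by simpa using tendsto_gaussianPDFReal_std_atBot.neg)]
    simp
  have h3 : ∫ z, max (x - z) 0 * gaussianPDFReal 0 1 z =
      ∫ z in Iic x, (x * gaussianPDFReal 0 1 z - z * gaussianPDFReal 0 1 z) := by
    rw [← integral_indicator measurableSet_Iic]
    congr 1
    ext z
    by_cases hz : z ≤ x
    · rw [indicator_of_mem (by exact hz), max_eq_left (by linarith)]; ring
    · rw [indicator_of_notMem (by exact hz), max_eq_right (by push Not at hz; linarith), zero_mul]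
  rw [h3, integral_sub (hφ.const_mul x).integrableOn
    integrable_mul_gaussianPDFReal_std.integrableOn, integral_const_mul, h1, h2, f]
  ring

lemma integrable_max_sub_mul_gaussianPDFReal (x : ℝ) :
    Integrable fun z => max (x - z) 0 * gaussianPDFReal 0 1 z := by
  refine (((integrable_gaussianPDFReal 0 1).const_mul |x|).add
    integrable_mul_gaussianPDFReal_std.norm).mono' ?_ (ae_of_all _ fun z => ?_)
  · exact (Measurable.mul (by fun_prop) (measurable_gaussianPDFReal 0 1)).aestronglyMeasurable
  · have h0 := gaussianPDFReal_nonneg 0 1 z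
    simp only [Pi.add_apply, norm_mul, Real.norm_eq_abs, abs_of_nonneg h0, ← add_mul]
    refine mul_le_mul_of_nonneg_right ?_ h0
    rw [abs_of_nonneg (le_max_right _ _)]
    refine max_le ?_ (by positivity)
    linarith [le_abs_self x, neg_abs_le z]

lemma f_mono : Monotone f := by
  intro x y hxy
  rw [f_eq_integral, f_eq_integral]
  refine integral_mono (integrable_max_sub_mul_gaussianPDFReal x)
    (integrable_max_sub_mul_gaussianPDFReal y) fun z => ?_
  have := gaussianPDFReal_nonneg 0 1 z
  dsimp only
  gcongr

lemma f_neg_le {y : ℝ} (hy : 0 ≤ y) : f (-y) ≤ gaussianPDFReal 0 1 y := by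
  have h : gaussianPDFReal 0 1 (-y) = gaussianPDFReal 0 1 y := by
    rw [gaussianPDFReal_std, gaussianPDFReal_std, neg_sq]
  rw [f, h]
  have := mul_nonneg hy (cdf_nonneg (gaussianReal 0 1) (-y))
  linarith

lemma le_f_neg {x : ℝ} (hx : 0 ≤ x) : gaussianPDFReal 0 1 (x + 2) ≤ f (-x) := by
  rw [f_eq_integral]
  calc gaussianPDFReal 0 1 (x + 2)
      = ∫ z in Icc (-x - 2) (-x - 1), gaussianPDFReal 0 1 (x + 2) := by
        simp only [integral_const, measureReal_restrict_apply_univ, Real.volume_real_Icc,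
          smul_eq_mul]
        norm_num
    _ ≤ ∫ z in Icc (-x - 2) (-x - 1), max (-x - z) 0 * gaussianPDFReal 0 1 z := by
        refine setIntegral_mono_on (by simp)
          (integrable_max_sub_mul_gaussianPDFReal _).integrableOn measurableSet_Icc fun z hz => ?_
        have h1 : (1 : ℝ) ≤ max (-x - z) 0 := le_max_of_le_left (by linarith [hz.2])
        have h2 : gaussianPDFReal 0 1 (x + 2) ≤ gaussianPDFReal 0 1 z := by
          refine gaussianPDFReal_std_le ?_
          rw [abs_of_nonpos (by linarith [hz.2]), abs_of_nonneg (by linarith)]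
          linarith [hz.1]
        nlinarith [gaussianPDFReal_nonneg 0 1 (x + 2)]
    _ ≤ ∫ z, max (-x - z) 0 * gaussianPDFReal 0 1 z :=
        setIntegral_le_integral (integrable_max_sub_mul_gaussianPDFReal _)
          (ae_of_all _ fun z => mul_nonneg (le_max_right _ _) (gaussianPDFReal_nonneg 0 1 z))

lemma f_pos (x : ℝ) : 0 < f x := by
  have h := le_f_neg (abs_nonneg x)
  exact lt_of_lt_of_le (lt_of_lt_of_le (gaussianPDFReal_pos 0 1 _ one_ne_zero) h)
    (f_mono (neg_abs_le x))

/-- `f` decays like a Gaussian density: halving a large negative argument multiplies the value of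
`f` by more than any given factor. -/
lemma exists_mul_f_neg_lt (R : ℝ) :
    ∃ Y : ℝ, 0 < Y ∧ ∀ y, Y ≤ y → ∀ x, 0 ≤ x → x ≤ y / 2 - 2 → R * f (-y) < f (-x) := by
  refine ⟨max 4 R, by positivity, fun y hy x hx hxy => ?_⟩
  have hy4 : 4 ≤ y := (le_max_left _ _).trans hy
  have hyR : R ≤ y := (le_max_right _ _).trans hy
  have h1 : f (-y) ≤ gaussianPDFReal 0 1 y := f_neg_le (by linarith)
  have h2 : gaussianPDFReal 0 1 (y / 2) ≤ f (-x) := by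
    refine le_trans (gaussianPDFReal_std_le ?_) (le_f_neg hx)
    rw [abs_of_nonneg (by linarith), abs_of_nonneg (by linarith)]
    linarith
  refine lt_of_lt_of_le ?_ h2
  have h3 : y * gaussianPDFReal 0 1 y < gaussianPDFReal 0 1 (y / 2) := by
    rw [gaussianPDFReal_std, gaussianPDFReal_std, mul_left_comm]
    refine mul_lt_mul_of_pos_left ?_ (by positivity)
    have h4 : y < Real.exp (3 * y ^ 2 / 8) := by
      have := Real.add_one_le_exp (3 * y ^ 2 / 8)
      nlinarith
    calc y * Real.exp (-(y ^ 2 / 2)) < Real.exp (3 * y ^ 2 / 8) * Real.exp (-(y ^ 2 / 2)) := by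
          gcongr
      _ = Real.exp (-((y / 2) ^ 2 / 2)) := by rw [← Real.exp_add]; ring_nf
  have := f_pos (-y)
  nlinarith

end NormalFunction

/-! ### Sample paths of the algorithm -/

section Paths

variable {k : ℕ} (σ : Fin k → ℝ) (rule : Knowledge k → Fin k) (x : Fin k → ℕ → ℝ)

/-- The arm that is pulled in round `s + 1`. -/
noncomputable def pulledArm (s : ℕ) : Fin k := rule (knowledge σ rule x s)

/-- The number of pulls of arm `i` in the first `t` rounds. -/
noncomputable def pulls (i : Fin k) (t : ℕ) : ℕ :=
  ∑ s ∈ Finset.range t, if pulledArm σ rule x s = i then 1 else 0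

/-- The sum of the centred rewards `x - m` that arm `i` has yielded in the first `t` rounds. -/
noncomputable def deviation (m : ℝ) (i : Fin k) (t : ℕ) : ℝ :=
  ∑ s ∈ Finset.range t, if pulledArm σ rule x s = i then x i (s + 1) - m else 0

/-- The posterior mean of arm `i` after `t` rounds. -/
noncomputable def mean (t : ℕ) (i : Fin k) : ℝ := (knowledge σ rule x t).1 i

/-- The distance `|θ_i - max_{j ≠ i} θ_j|` of arm `i` after `t` rounds. -/
noncomputable def gap (t : ℕ) (i : Fin k) : ℝ :=
  |mean σ rule x t i - maxOther (mean σ rule x t) i|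

/-- The value of `ζ` for an arm with reward standard deviation `s` after `n ≥ 1` pulls. -/
noncomputable def zeta (s : ℝ) (n : ℕ) : ℝ := s / Real.sqrt (n * (n + 1))

@[simp] lemma pulls_zero (i : Fin k) : pulls σ rule x i 0 = 0 := rfl

lemma pulls_succ (i : Fin k) (t : ℕ) :
    pulls σ rule x i (t + 1) = pulls σ rule x i t + if pulledArm σ rule x t = i then 1 else 0 :=
  Finset.sum_range_succ _ _

lemma deviation_succ (m : ℝ) (i : Fin k) (t : ℕ) :
    deviation σ rule x m i (t + 1) = deviation σ rule x m i t +
      if pulledArm σ rule x t = i then x i (t + 1) - m else 0 :=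
  Finset.sum_range_succ _ _

lemma sum_pulls (t : ℕ) : ∑ i, pulls σ rule x i t = t := by
  simp only [pulls]
  rw [Finset.sum_comm]
  simp

lemma pulls_mono (i : Fin k) : Monotone (pulls σ rule x i) :=
  monotone_nat_of_le_succ fun t => by rw [pulls_succ]; exact Nat.le_add_right _ _

lemma pulls_le (i : Fin k) (t : ℕ) : pulls σ rule x i t ≤ t := by
  calc pulls σ rule x i t ≤ ∑ j, pulls σ rule x j t :=
        Finset.single_le_sum (f := fun j => pulls σ rule x j t) (fun _ _ => Nat.zero_le _)
          (Finset.mem_univ i)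
    _ = t := sum_pulls σ rule x t

/-- Arm `i` has been pulled for the `(m + 1)`-st time in some round. -/
lemma exists_pull {i : Fin k} {t m : ℕ} (h : m < pulls σ rule x i t) :
    ∃ s < t, pulledArm σ rule x s = i ∧ pulls σ rule x i s = m := by
  induction t with
  | zero => simp at h
  | succ t ih =>
    by_cases hm : m < pulls σ rule x i t
    · obtain ⟨s, hs, h1⟩ := ih hm
      exact ⟨s, by omega, h1⟩
    · rw [pulls_succ] at h
      by_cases ha : pulledArm σ rule x t = i
      · exact ⟨t, by omega, ha, by simp only [ha, if_true] at h; omega⟩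
      · simp only [ha, if_false] at h; omega

lemma nextVar_div {s : ℝ} (hs : 0 < s) (n : ℕ) :
    nextVar s (ENNReal.ofReal (s ^ 2) / n) = ENNReal.ofReal (s ^ 2) / (n + 1 : ℕ) := by
  have h0 : ENNReal.ofReal (s ^ 2) ≠ 0 := (ENNReal.ofReal_pos.2 (pow_pos hs 2)).ne'
  rw [nextVar, ENNReal.inv_div (Or.inr ENNReal.ofReal_ne_top) (Or.inr h0), ENNReal.div_eq_inv_mul,
    ← mul_add_one, ENNReal.mul_inv (Or.inr (by finiteness)) (Or.inr (by simp)), inv_inv,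
    ENNReal.div_eq_inv_mul, mul_comm]
  push_cast
  rfl

lemma knowledge_var (hσ : ∀ i, 0 < σ i) (t : ℕ) (i : Fin k) :
    (knowledge σ rule x t).2 i = ENNReal.ofReal (σ i ^ 2) / pulls σ rule x i t := by
  induction t with
  | zero =>
    have h0 : ENNReal.ofReal (σ i ^ 2) ≠ 0 := (ENNReal.ofReal_pos.2 (pow_pos (hσ i) 2)).ne'
    simp [knowledge, prior, ENNReal.div_zero h0]
  | succ t ih =>
    rw [pulls_succ]
    simp only [knowledge, update]
    by_cases ha : i = pulledArm σ rule x t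
    · rw [if_pos ha.symm, ← nextVar_div (hσ _), ← ih, ha, pulledArm, Function.update_self]
    · rw [if_neg (Ne.symm ha), add_zero, ← ih]
      exact Function.update_of_ne ha _ _

lemma pulls_mul_mean_sub (hσ : ∀ i, 0 < σ i) (m : ℝ) (t : ℕ) (i : Fin k) :
    pulls σ rule x i t * (mean σ rule x t i - m) = deviation σ rule x m i t := by
  induction t with
  | zero => simp [deviation]
  | succ t ih =>
    rw [pulls_succ, deviation_succ, ← ih]
    by_cases ha : i = pulledArm σ rule x t
    · have hs : σ i ≠ 0 := (hσ i).ne'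
      have h0 : ENNReal.ofReal (σ i ^ 2) ≠ 0 := (ENNReal.ofReal_pos.2 (pow_pos (hσ i) 2)).ne'
      have h1 : mean σ rule x (t + 1) i = nextMean (σ i) (mean σ rule x t i)
          ((knowledge σ rule x t).2 i) (x i (t + 1)) := by
        simp only [mean, knowledge, update]
        rw [ha, pulledArm, Function.update_self]
      rw [h1, knowledge_var σ rule x hσ, nextMean,
        ENNReal.inv_div (Or.inr ENNReal.ofReal_ne_top) (Or.inr h0), ENNReal.toReal_div,
        ENNReal.toReal_natCast, ENNReal.toReal_ofReal (sq_nonneg _), if_pos ha.symm,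
        if_pos ha.symm]
      push_cast
      have : (pulls σ rule x i t : ℝ) + 1 ≠ 0 := by positivity
      field_simp
      ring
    · have h1 : mean σ rule x (t + 1) i = mean σ rule x t i := by
        simp only [mean, knowledge, update]
        exact Function.update_of_ne ha _ _
      rw [h1, if_neg (Ne.symm ha), if_neg (Ne.symm ha)]
      simp

lemma zetaSq_knowledge (hσ : ∀ i, 0 < σ i) {t : ℕ} {i : Fin k} (h : pulls σ rule x i t ≠ 0) :
    zetaSq σ (knowledge σ rule x t) i = ENNReal.ofReal (zeta (σ i) (pulls σ rule x i t) ^ 2) := by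
  have hn : (0 : ℝ) < pulls σ rule x i t := by exact_mod_cast Nat.pos_of_ne_zero h
  rw [zetaSq, knowledge_var σ rule x hσ, nextVar_div (hσ i), ← ENNReal.ofReal_natCast,
    ← ENNReal.ofReal_natCast, ← ENNReal.ofReal_div_of_pos hn,
    ← ENNReal.ofReal_div_of_pos (by push_cast; positivity),
    ← ENNReal.ofReal_sub _ (by positivity), zeta, div_pow, Real.sq_sqrt (by positivity)]
  congr 1
  push_cast
  field_simp
  ring

lemma zeta_pos {s : ℝ} (hs : 0 < s) {n : ℕ} (hn : n ≠ 0) : 0 < zeta s n := by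
  have : (0 : ℝ) < n := by exact_mod_cast Nat.pos_of_ne_zero hn
  rw [zeta]; positivity

lemma kgValue_of_pulls_ne_zero (hσ : ∀ i, 0 < σ i) {t : ℕ} {i : Fin k}
    (h : pulls σ rule x i t ≠ 0) :
    kgValue σ (knowledge σ rule x t) i =
      ENNReal.ofReal (zeta (σ i) (pulls σ rule x i t) *
        f (-(gap σ rule x t i / zeta (σ i) (pulls σ rule x i t)))) := by
  have hz := zeta_pos (hσ i) h
  rw [kgValue, zetaSq_knowledge σ rule x hσ h, if_neg ENNReal.ofReal_ne_top,
    ENNReal.toReal_ofReal (sq_nonneg _), Real.sqrt_sq hz.le, neg_div]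
  rfl

lemma kgValue_of_pulls_eq_zero (hσ : ∀ i, 0 < σ i) {t : ℕ} {i : Fin k}
    (h : pulls σ rule x i t = 0) : kgValue σ (knowledge σ rule x t) i = ⊤ := by
  have h0 : ENNReal.ofReal (σ i ^ 2) ≠ 0 := (ENNReal.ofReal_pos.2 (pow_pos (hσ i) 2)).ne'
  have h1 : zetaSq σ (knowledge σ rule x t) i = ⊤ := by
    rw [zetaSq, knowledge_var σ rule x hσ, nextVar_div (hσ i), h]
    simp [ENNReal.div_zero h0]
  rw [kgValue, if_pos h1]

variable {σ rule}

/-- If the arm that is pulled next has been pulled before, then so has every other arm, and no arm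
has a larger knowledge gradient value. -/
lemma pulledArm_spec (hσ : ∀ i, 0 < σ i) (hrule : IsKGRule σ rule) {s : ℕ} {i : Fin k}
    (hi : pulledArm σ rule x s = i) (hn : pulls σ rule x i s ≠ 0) (c : Fin k) :
    pulls σ rule x c s ≠ 0 ∧
      zeta (σ c) (pulls σ rule x c s) *
          f (-(gap σ rule x s c / zeta (σ c) (pulls σ rule x c s))) ≤
        zeta (σ i) (pulls σ rule x i s) *
          f (-(gap σ rule x s i / zeta (σ i) (pulls σ rule x i s))) := by
  have h := hrule.isMax (knowledge σ rule x s) c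
  rw [show rule (knowledge σ rule x s) = i from hi, kgValue_of_pulls_ne_zero σ rule x hσ hn] at h
  have hc : pulls σ rule x c s ≠ 0 := by
    intro hc
    rw [kgValue_of_pulls_eq_zero σ rule x hσ hc] at h
    simp at h
  rw [kgValue_of_pulls_ne_zero σ rule x hσ hc] at h
  exact ⟨hc, (ENNReal.ofReal_le_ofReal_iff
    (mul_nonneg (zeta_pos (hσ i) hn).le (f_pos _).le)).1 h⟩

end Paths

/-! ### Maximum over the other arms -/

lemma le_maxOther {k : ℕ} (g : Fin k → ℝ) {i j : Fin k} (h : j ≠ i) : g j ≤ maxOther g i :=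
  le_ciSup (f := fun j : {j : Fin k // j ≠ i} => g j) (Set.finite_range _).bddAbove ⟨j, h⟩

lemma exists_maxOther_eq {k : ℕ} (hk : 2 ≤ k) (g : Fin k → ℝ) (i : Fin k) :
    ∃ j, j ≠ i ∧ maxOther g i = g j := by
  have : Nontrivial (Fin k) := Fin.nontrivial_iff_two_le.2 hk
  obtain ⟨j0, hj0⟩ := exists_ne i
  have : Nonempty {j : Fin k // j ≠ i} := ⟨⟨j0, hj0⟩⟩
  obtain ⟨j, hj⟩ := exists_eq_ciSup_of_finite (f := fun j : {j : Fin k // j ≠ i} => g j)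
  exact ⟨j, j.2, hj.symm⟩

/-! ### Measurability and the history of the rewards -/

section Measurability

variable {k : ℕ} {σ : Fin k → ℝ} {rule : Knowledge k → Fin k}

lemma measurable_knowledge {Ω : Type*} [MeasurableSpace Ω] (hrule : Measurable rule)
    {X : Fin k → ℕ → Ω → ℝ} {t : ℕ} (hX : ∀ i s, s ≤ t → Measurable (X i s)) :
    Measurable fun ω => knowledge σ rule (fun i s => X i s ω) t := by
  induction t with
  | zero => exact measurable_const
  | succ t ih =>
    have hS := ih fun i s hs => hX i s (by omega)
    have ha := hrule.comp hS
    have hset : ∀ i, MeasurableSet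
        {ω | i = rule (knowledge σ rule (fun i s => X i s ω) t)} := fun i => by
      convert! ha (measurableSet_singleton i) using 1
      ext ω
      simp [eq_comm]
    refine Measurable.prodMk (measurable_pi_lambda _ fun i => ?_)
      (measurable_pi_lambda _ fun i => ?_)
    · have h1 : Measurable fun ω => (knowledge σ rule (fun i s => X i s ω) t).1 i :=
        (measurable_pi_apply i).comp (measurable_fst.comp hS)
      have h2 : Measurable fun ω => (knowledge σ rule (fun i s => X i s ω) t).2 i :=
        (measurable_pi_apply i).comp (measurable_snd.comp hS)
      have h3 := hX i (t + 1) le_rfl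
      have h4 : Measurable fun ω => nextMean (σ i) ((knowledge σ rule (fun i s => X i s ω) t).1 i)
          ((knowledge σ rule (fun i s => X i s ω) t).2 i) (X i (t + 1) ω) := by
        unfold nextMean
        fun_prop
      have h5 : Measurable fun ω => if i = rule (knowledge σ rule (fun i s => X i s ω) t) then
          nextMean (σ i) ((knowledge σ rule (fun i s => X i s ω) t).1 i)
            ((knowledge σ rule (fun i s => X i s ω) t).2 i) (X i (t + 1) ω)
          else (knowledge σ rule (fun i s => X i s ω) t).1 i := Measurable.ite (hset i) h4 h1
      convert! h5 using 1
      ext ω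
      by_cases hi : i = rule (knowledge σ rule (fun i s => X i s ω) t)
      · rw [if_pos hi, Function.update_apply, if_pos hi, ← hi]
      · rw [if_neg hi, Function.update_of_ne hi]
    · have h2 : Measurable fun ω => (knowledge σ rule (fun i s => X i s ω) t).2 i :=
        (measurable_pi_apply i).comp (measurable_snd.comp hS)
      have h4 : Measurable fun ω => nextVar (σ i)
          ((knowledge σ rule (fun i s => X i s ω) t).2 i) := by
        unfold nextVar
        fun_prop
      have h5 : Measurable fun ω => if i = rule (knowledge σ rule (fun i s => X i s ω) t) then
          nextVar (σ i) ((knowledge σ rule (fun i s => X i s ω) t).2 i)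
          else (knowledge σ rule (fun i s => X i s ω) t).2 i := Measurable.ite (hset i) h4 h2
      convert! h5 using 1
      ext ω
      by_cases hi : i = rule (knowledge σ rule (fun i s => X i s ω) t)
      · rw [if_pos hi, Function.update_apply, if_pos hi, ← hi]
      · rw [if_neg hi, Function.update_of_ne hi]

lemma measurable_pulledArm {Ω : Type*} [MeasurableSpace Ω] (hrule : Measurable rule)
    {X : Fin k → ℕ → Ω → ℝ} {t : ℕ} (hX : ∀ i s, s ≤ t → Measurable (X i s)) :
    Measurable fun ω => pulledArm σ rule (fun i s => X i s ω) t :=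
  hrule.comp (measurable_knowledge hrule hX)

lemma measurable_pulls {Ω : Type*} [MeasurableSpace Ω] (hrule : Measurable rule)
    {X : Fin k → ℕ → Ω → ℝ} {t : ℕ} (hX : ∀ i s, s ≤ t → Measurable (X i s)) (i : Fin k) :
    Measurable fun ω => pulls σ rule (fun i s => X i s ω) i t := by
  refine Finset.measurable_sum _ fun s hs => ?_
  have hs := Finset.mem_range.1 hs
  exact Measurable.ite ((measurable_pulledArm hrule fun i r hr => hX i r (by omega))
    (measurableSet_singleton i)) measurable_const measurable_const

lemma measurable_deviation {Ω : Type*} [MeasurableSpace Ω] (hrule : Measurable rule)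
    {X : Fin k → ℕ → Ω → ℝ} {t : ℕ} (hX : ∀ i s, s ≤ t → Measurable (X i s)) (m : ℝ) (i : Fin k) :
    Measurable fun ω => deviation σ rule (fun i s => X i s ω) m i t := by
  refine Finset.measurable_sum _ fun s hs => ?_
  have hs := Finset.mem_range.1 hs
  exact Measurable.ite ((measurable_pulledArm hrule fun i r hr => hX i r (by omega))
    (measurableSet_singleton i)) ((hX i (s + 1) (by omega)).sub_const m) measurable_const

lemma measurable_recommended {Ω : Type*} [MeasurableSpace Ω] (hrule : Measurable rule)
    {recom : (Fin k → ℝ) → Fin k} (hrecom : Measurable recom)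
    {X : Fin k → ℕ → Ω → ℝ} (hX : ∀ i s, Measurable (X i s)) (t : ℕ) :
    Measurable fun ω => recommended σ rule recom (fun i s => X i s ω) t :=
  hrecom.comp (measurable_fst.comp (measurable_knowledge hrule fun i s _ => hX i s))

/-- The σ-algebra generated by the rewards of the rounds up to `s`. -/
abbrev history {Ω : Type*} (X : Fin k → ℕ → Ω → ℝ) (s : ℕ) : MeasurableSpace Ω :=
  ⨆ p ∈ {p : Fin k × ℕ | p.2 ≤ s}, MeasurableSpace.comap (X p.1 p.2) inferInstance

lemma measurable_history {Ω : Type*} (X : Fin k → ℕ → Ω → ℝ) {r s : ℕ} (h : r ≤ s) (i : Fin k) :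
    Measurable[history X s] (X i r) := by
  refine measurable_iff_comap_le.2 ?_
  exact le_iSup₂_of_le (f := fun (p : Fin k × ℕ) (_ : p ∈ {p : Fin k × ℕ | p.2 ≤ s}) =>
    MeasurableSpace.comap (X p.1 p.2) inferInstance) (i, r) h le_rfl

lemma history_mono {Ω : Type*} (X : Fin k → ℕ → Ω → ℝ) : Monotone (history X) :=
  fun _ _ h => biSup_mono fun _ hp => le_trans hp h

lemma history_le {Ω : Type*} [m : MeasurableSpace Ω] {X : Fin k → ℕ → Ω → ℝ}
    (hX : ∀ i t, Measurable (X i t)) (s : ℕ) : history X s ≤ m :=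
  iSup₂_le fun p _ => (hX p.1 p.2).comap_le

end Measurability

/-! ### Exponential martingales of the observed rewards -/

section Martingale

variable {k : ℕ} {μ σ : Fin k → ℝ} {rule : Knowledge k → Fin k}
  {Ω : Type*} [MeasurableSpace Ω] {P : Measure Ω} [IsProbabilityMeasure P]
  {X : Fin k → ℕ → Ω → ℝ}

omit [IsProbabilityMeasure P] in
lemma indep_history (hX : IsRewardModel P μ σ X) (s : ℕ) (i : Fin k) :
    Indep (history X s) (MeasurableSpace.comap (X i (s + 1)) inferInstance) P := by
  have h := indep_iSup_of_disjoint (S := {p : Fin k × ℕ | p.2 ≤ s}) (T := {(i, s + 1)})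
    (fun p : Fin k × ℕ => (hX.measurable p.1 p.2).comap_le)
    ((iIndepFun_iff_iIndep ..).1 hX.indep) (by simp)
  simpa [history] using h

lemma lintegral_exp_gaussianReal (m c : ℝ) (v : ℝ≥0) :
    ∫⁻ x, ENNReal.ofReal (Real.exp (c * (x - m) - c ^ 2 * v / 2)) ∂gaussianReal m v = 1 := by
  have h : ∀ x : ℝ, Real.exp (c * (x - m) - c ^ 2 * v / 2) =
      Real.exp (-(c * m) - c ^ 2 * v / 2) * Real.exp (c * x) := fun x => by
    rw [← Real.exp_add]; ring_nf
  simp_rw [h]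
  rw [← ofReal_integral_eq_lintegral_ofReal ((integrable_exp_mul_gaussianReal c).const_mul _)
    (ae_of_all _ fun x => by positivity), integral_const_mul]
  have h2 := congrFun (mgf_id_gaussianReal (μ := m) (v := v)) c
  simp only [mgf, id] at h2
  rw [h2, ← Real.exp_add]
  ring_nf
  simp

/-- A factor `exp (c (x - μ_a) - c² σ_a² / 2)`, where `x` is the next reward of the arm `a` and `c`,
`a` are determined by the past, does not change the expectation of a quantity that is determined
by the past. -/
lemma lintegral_mul_exp (hX : IsRewardModel P μ σ X) {s : ℕ} {Y : Ω → ℝ≥0∞} {c : Ω → ℝ}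
    {A : Ω → Fin k} (hY : Measurable[history X s] Y) (hc : Measurable[history X s] c)
    (hA : Measurable[history X s] A) :
    ∫⁻ ω, Y ω * ENNReal.ofReal (Real.exp (c ω * (X (A ω) (s + 1) ω - μ (A ω)) -
      c ω ^ 2 * σ (A ω) ^ 2 / 2)) ∂P = ∫⁻ ω, Y ω ∂P := by
  classical
  have hle := history_le hX.measurable s
  have hYi : ∀ i, Measurable[history X s] fun ω => if A ω = i then Y ω else 0 := fun i =>
    Measurable.ite (hA (measurableSet_singleton i)) hY (@measurable_const _ _ _ (history X s) _)
  have hterm : ∀ i, ∫⁻ ω, (if A ω = i then Y ω else 0) *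
      ENNReal.ofReal (Real.exp (c ω * (X i (s + 1) ω - μ i) - c ω ^ 2 * σ i ^ 2 / 2)) ∂P =
      ∫⁻ ω, (if A ω = i then Y ω else 0) ∂P := by
    intro i
    have hpair : Measurable[history X s] fun ω => ((if A ω = i then Y ω else 0), c ω) :=
      (hYi i).prodMk hc
    have hind : IndepFun (fun ω => ((if A ω = i then Y ω else 0), c ω)) (X i (s + 1)) P :=
      (IndepFun_iff_Indep ..).2
        (indep_of_indep_of_le_left (indep_history hX s i) hpair.comap_le)
    have hpair' := hpair.mono hle le_rfl
    have hXi := hX.measurable i (s + 1)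
    have hmap := (indepFun_iff_map_prod_eq_prod_map_map hpair'.aemeasurable hXi.aemeasurable).1 hind
    let g : (ℝ≥0∞ × ℝ) × ℝ → ℝ≥0∞ := fun p =>
      p.1.1 * ENNReal.ofReal (Real.exp (p.1.2 * (p.2 - μ i) - p.1.2 ^ 2 * σ i ^ 2 / 2))
    have hg : Measurable g := by fun_prop
    have h1 : ∫⁻ ω, g (((if A ω = i then Y ω else 0), c ω), X i (s + 1) ω) ∂P =
        ∫⁻ p, g p ∂(P.map fun ω => (((if A ω = i then Y ω else 0), c ω), X i (s + 1) ω)) :=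
      (lintegral_map hg (hpair'.prodMk hXi)).symm
    have : IsProbabilityMeasure (P.map (X i (s + 1))) :=
      Measure.isProbabilityMeasure_map hXi.aemeasurable
    have h2 : ∀ p : ℝ≥0∞ × ℝ, ∫⁻ x, g (p, x) ∂(P.map (X i (s + 1))) = p.1 := by
      intro p
      have h3 := lintegral_exp_gaussianReal (μ i) p.2 (σ i ^ 2).toNNReal
      rw [Real.coe_toNNReal _ (sq_nonneg _)] at h3
      change ∫⁻ x, p.1 * _ ∂_ = _
      rw [hX.law, lintegral_const_mul _ (by fun_prop), h3, mul_one]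
    refine h1.trans ?_
    rw [hmap, lintegral_prod _ hg.aemeasurable]
    simp_rw [h2]
    rw [lintegral_map measurable_fst hpair']
  have hsum : ∀ (F : Fin k → Ω → ℝ≥0∞) ω,
      Y ω * F (A ω) ω = ∑ i, (if A ω = i then Y ω else 0) * F i ω := by
    intro F ω
    rw [Finset.sum_eq_single (A ω)]
    · simp
    · intro i _ hi; simp [Ne.symm hi]
    · simp
  have hsum1 := hsum fun i ω =>
    ENNReal.ofReal (Real.exp (c ω * (X i (s + 1) ω - μ i) - c ω ^ 2 * σ i ^ 2 / 2))
  have hsum2 := hsum fun _ _ => 1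
  have hc' := hc.mono hle le_rfl
  simp only [mul_one] at hsum2
  rw [lintegral_congr hsum1, lintegral_congr hsum2, lintegral_finsetSum, lintegral_finsetSum]
  · exact Finset.sum_congr rfl fun i _ => hterm i
  · exact fun i _ => (hYi i).mono hle le_rfl
  · intro i _
    have h4 := hX.measurable i (s + 1)
    exact ((hYi i).mono hle le_rfl).mul (by fun_prop)

variable (μ σ rule) in
/-- The exponent `∑ (c_s (x_s - μ_{a_s}) - c_s² σ_{a_s}² / 2)`, where `a_s` and `x_s` are the arm
and the reward of round `s + 1`. -/
noncomputable def expSum (x : Fin k → ℕ → ℝ) (c : ℕ → ℝ) (t : ℕ) : ℝ :=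
  ∑ s ∈ Finset.range t, (c s * (x (pulledArm σ rule x s) (s + 1) - μ (pulledArm σ rule x s)) -
    c s ^ 2 * σ (pulledArm σ rule x s) ^ 2 / 2)

lemma expSum_succ (x : Fin k → ℕ → ℝ) (c : ℕ → ℝ) (t : ℕ) :
    expSum μ σ rule x c (t + 1) = expSum μ σ rule x c t +
      (c t * (x (pulledArm σ rule x t) (t + 1) - μ (pulledArm σ rule x t)) -
        c t ^ 2 * σ (pulledArm σ rule x t) ^ 2 / 2) :=
  Finset.sum_range_succ _ _

lemma measurable_expSum {Ω : Type*} [MeasurableSpace Ω] (hrule : Measurable rule)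
    {X : Fin k → ℕ → Ω → ℝ} {t : ℕ} (hX : ∀ i s, s ≤ t → Measurable (X i s)) {c : ℕ → Ω → ℝ}
    (hc : ∀ s, s < t → Measurable (c s)) :
    Measurable fun ω => expSum μ σ rule (fun i s => X i s ω) (fun s => c s ω) t := by
  refine Finset.measurable_sum _ fun s hs => ?_
  have hs := Finset.mem_range.1 hs
  have hA := measurable_pulledArm (σ := σ) hrule (X := X) (t := s) fun i r hr => hX i r (by omega)
  have h1 : Measurable fun ω => X (pulledArm σ rule (fun i s => X i s ω) s) (s + 1) ω := by
    have h2 : Measurable fun ω => (fun i => X i (s + 1) ω) :=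
      measurable_pi_lambda _ fun i => hX i (s + 1) (by omega)
    have h3 : Measurable fun p : (Fin k → ℝ) × Fin k => p.1 p.2 :=
      measurable_from_prod_countable_left fun i => measurable_pi_apply i
    exact h3.comp (h2.prodMk hA)
  have h2 : Measurable fun ω => μ (pulledArm σ rule (fun i s => X i s ω) s) :=
    (measurable_of_finite μ).comp hA
  have h3 : Measurable fun ω => σ (pulledArm σ rule (fun i s => X i s ω) s) :=
    (measurable_of_finite σ).comp hA
  have h4 := hc s hs
  exact (h4.mul (h1.sub h2)).sub (((h4.pow_const 2).mul (h3.pow_const 2)).div_const 2)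

lemma lintegral_exp_expSum (hrule : Measurable rule) (hX : IsRewardModel P μ σ X) {c : ℕ → Ω → ℝ}
    (hc : ∀ s, Measurable[history X s] (c s)) (t : ℕ) :
    ∫⁻ ω, ENNReal.ofReal (Real.exp
      (expSum μ σ rule (fun i s => X i s ω) (fun s => c s ω) t)) ∂P = 1 := by
  induction t with
  | zero => simp [expSum]
  | succ t ih =>
    simp_rw [expSum_succ, Real.exp_add, ENNReal.ofReal_mul (Real.exp_nonneg _)]
    rw [lintegral_mul_exp hX _ (hc t), ih]
    · exact @measurable_pulledArm k σ rule Ω (history X t) hrule X t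
        fun i r hr => measurable_history X hr i
    · refine ENNReal.measurable_ofReal.comp (Real.measurable_exp.comp ?_)
      exact @measurable_expSum k μ σ rule Ω (history X t) hrule X t
        (fun i r hr => measurable_history X hr i) c
        fun s hs => (hc s).mono (history_mono X hs.le) le_rfl

end Martingale

/-! ### Change of measure -/

section ChangeOfMeasure

variable {k : ℕ} {μ σ : Fin k → ℝ} {rule : Knowledge k → Fin k}

variable (μ σ rule) in
/-- The logarithm of the likelihood ratio of the observed rewards, when the means are `μ + h`
instead of `μ`. -/
noncomputable def logRatio (h : Fin k → ℝ) (x : Fin k → ℕ → ℝ) (t : ℕ) : ℝ :=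
  expSum μ σ rule x (fun s => h (pulledArm σ rule x s) / σ (pulledArm σ rule x s) ^ 2) t

lemma expSum_add (hσ : ∀ i, 0 < σ i) (h : Fin k → ℝ) (x : Fin k → ℕ → ℝ) (d : ℕ → ℝ) (t : ℕ) :
    expSum μ σ rule x
      (fun s => h (pulledArm σ rule x s) / σ (pulledArm σ rule x s) ^ 2 + d s) t =
      logRatio μ σ rule h x t + expSum (fun i => μ i + h i) σ rule x d t := by
  rw [logRatio, expSum, expSum, expSum, ← Finset.sum_add_distrib]
  refine Finset.sum_congr rfl fun s _ => ?_
  have := (hσ (pulledArm σ rule x s)).ne'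
  field_simp
  ring

/-- The exponent with `h / σ²` multiplied by `1 + β` controls the `(1 + β)`-th moment of the
likelihood ratio by the information `∑ n_i h_i² / σ_i²`. -/
lemma expSum_mul_ratio (hσ : ∀ i, 0 < σ i) (h : Fin k → ℝ) (x : Fin k → ℕ → ℝ) (β : ℝ) (t : ℕ) :
    expSum μ σ rule x
      (fun s => (1 + β) * (h (pulledArm σ rule x s) / σ (pulledArm σ rule x s) ^ 2)) t =
      (1 + β) * logRatio μ σ rule h x t -
        (β + β ^ 2) / 2 * ∑ i, pulls σ rule x i t * (h i ^ 2 / σ i ^ 2) := by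
  have h1 : ∑ i, (pulls σ rule x i t : ℝ) * (h i ^ 2 / σ i ^ 2) =
      ∑ s ∈ Finset.range t, h (pulledArm σ rule x s) ^ 2 / σ (pulledArm σ rule x s) ^ 2 := by
    simp only [pulls, Nat.cast_sum, Finset.sum_mul]
    rw [Finset.sum_comm]
    refine Finset.sum_congr rfl fun s _ => ?_
    simp
  rw [h1, logRatio, expSum, expSum, Finset.mul_sum, Finset.mul_sum, ← Finset.sum_sub_distrib]
  refine Finset.sum_congr rfl fun s _ => ?_
  have := (hσ (pulledArm σ rule x s)).ne'
  field_simp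
  ring

variable (σ rule) in
/-- Within `t` rounds, the sum of the centred rewards of arm `i`, multiplied by the sign `e`,
exceeds the line with slope `η / 2` and intercept `C` in the number of pulls. -/
def Crosses (m e η C : ℝ) (i : Fin k) (x : Fin k → ℕ → ℝ) (t : ℕ) : Prop :=
  ∃ r ≤ t, η / 2 * pulls σ rule x i r + C < e * deviation σ rule x m i r

open Classical in
variable (σ rule) in
/-- The exponent `e η / σ_i²` for the pulls of arm `i` before the line is crossed, `0` otherwise. -/
noncomputable def stoppedTilt (m e η C : ℝ) (i : Fin k) (x : Fin k → ℕ → ℝ) (s : ℕ) : ℝ :=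
  if pulledArm σ rule x s = i ∧ ¬Crosses σ rule m e η C i x s then e * η / σ i ^ 2 else 0

lemma le_expSum_stoppedTilt (hσ : ∀ i, 0 < σ i) {e η C : ℝ} (he : e ^ 2 = 1)
    (hη : 0 < η) (i : Fin k) (x : Fin k → ℕ → ℝ) {t : ℕ} (h : Crosses σ rule (μ i) e η C i x t) :
    η * C / σ i ^ 2 ≤ expSum μ σ rule x (stoppedTilt σ rule (μ i) e η C i x) t := by
  classical
  have hi := hσ i
  have hex : ∃ r, η / 2 * pulls σ rule x i r + C < e * deviation σ rule x (μ i) i r :=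
    ⟨h.choose, h.choose_spec.2⟩
  have hr0t : Nat.find hex ≤ t := by
    obtain ⟨r, hr, hc⟩ := h
    exact (Nat.find_min' hex hc).trans hr
  -- up to the first crossing the tilt is constant on the pulls of the arm `i`
  have h1 : ∀ r ≤ Nat.find hex, expSum μ σ rule x (stoppedTilt σ rule (μ i) e η C i x) r =
      e * η / σ i ^ 2 * deviation σ rule x (μ i) i r -
        η ^ 2 / (2 * σ i ^ 2) * pulls σ rule x i r := by
    intro r
    induction r with
    | zero => simp [expSum, deviation]
    | succ r ih =>
      intro hr
      have hnc : ¬Crosses σ rule (μ i) e η C i x r := by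
        rintro ⟨q, hq, hc⟩
        have := Nat.find_min' hex hc
        omega
      rw [expSum_succ, ih (by omega), deviation_succ, pulls_succ, stoppedTilt]
      by_cases ha : pulledArm σ rule x r = i
      · simp only [ha, hnc, if_true, not_false_eq_true, and_self]
        have : (e * η / σ i ^ 2) ^ 2 * σ i ^ 2 / 2 = η ^ 2 / (2 * σ i ^ 2) := by
          rw [div_pow, mul_pow, he]
          field_simp
        rw [this]
        push_cast
        ring
      · simp [ha]
  have h2 : ∀ r, Nat.find hex ≤ r → expSum μ σ rule x (stoppedTilt σ rule (μ i) e η C i x) r =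
      expSum μ σ rule x (stoppedTilt σ rule (μ i) e η C i x) (Nat.find hex) := by
    intro r hr
    induction r, hr using Nat.le_induction with
    | base => rfl
    | succ r hr ih =>
      have hc : Crosses σ rule (μ i) e η C i x r := ⟨_, hr, Nat.find_spec hex⟩
      rw [expSum_succ, ih, stoppedTilt]
      simp [hc]
  rw [h2 t hr0t, h1 _ le_rfl]
  have h3 := mul_lt_mul_of_pos_left (Nat.find_spec hex) (show 0 < η / σ i ^ 2 by positivity)
  have h4 : η / σ i ^ 2 * (η / 2 * pulls σ rule x i (Nat.find hex) + C) =
      η * C / σ i ^ 2 + η ^ 2 / (2 * σ i ^ 2) * pulls σ rule x i (Nat.find hex) := by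
    field_simp
    ring
  have h5 : η / σ i ^ 2 * (e * deviation σ rule x (μ i) i (Nat.find hex)) =
      e * η / σ i ^ 2 * deviation σ rule x (μ i) i (Nat.find hex) := by ring
  linarith

lemma measurableSet_crosses {Ω : Type*} [MeasurableSpace Ω] (hrule : Measurable rule)
    {X : Fin k → ℕ → Ω → ℝ} {t : ℕ} (hX : ∀ i s, s ≤ t → Measurable (X i s)) (m e η C : ℝ)
    (i : Fin k) : MeasurableSet {ω | Crosses σ rule m e η C i (fun i s => X i s ω) t} := by
  have h : {ω | Crosses σ rule m e η C i (fun i s => X i s ω) t} = ⋃ r ∈ Finset.range (t + 1),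
      {ω | η / 2 * pulls σ rule (fun i s => X i s ω) i r + C <
        e * deviation σ rule (fun i s => X i s ω) m i r} := by
    ext ω
    simp [Crosses]
  rw [h]
  refine Finset.measurableSet_biUnion _ fun r hr => ?_
  have hr : r ≤ t := Nat.lt_succ_iff.1 (Finset.mem_range.1 hr)
  have h1 := measurable_pulls (σ := σ) hrule (fun i s hs => hX i s (hs.trans hr)) i
  have h2 := measurable_deviation (σ := σ) hrule (fun i s hs => hX i s (hs.trans hr)) m i
  have h3 : Measurable fun ω => (pulls σ rule (fun i s => X i s ω) i r : ℝ) :=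
    measurable_from_nat.comp h1
  exact measurableSet_lt ((h3.const_mul _).add_const _) (h2.const_mul _)

lemma measurable_stoppedTilt {Ω : Type*} [MeasurableSpace Ω] (hrule : Measurable rule)
    {X : Fin k → ℕ → Ω → ℝ} {t : ℕ} (hX : ∀ i s, s ≤ t → Measurable (X i s)) (m e η C : ℝ)
    (i : Fin k) : Measurable fun ω => stoppedTilt σ rule m e η C i (fun i s => X i s ω) t := by
  classical
  refine Measurable.ite ?_ measurable_const measurable_const
  exact ((measurable_pulledArm hrule hX) (measurableSet_singleton i)).inter
    (measurableSet_crosses hrule hX m e η C i).compl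

lemma measurable_ratioTilt {Ω : Type*} [MeasurableSpace Ω] (hrule : Measurable rule)
    {X : Fin k → ℕ → Ω → ℝ} {t : ℕ} (hX : ∀ i s, s ≤ t → Measurable (X i s)) (h : Fin k → ℝ) :
    Measurable fun ω => h (pulledArm σ rule (fun i s => X i s ω) t) /
      σ (pulledArm σ rule (fun i s => X i s ω) t) ^ 2 :=
  (measurable_of_finite fun i => h i / σ i ^ 2).comp (measurable_pulledArm hrule hX)

lemma measurable_const_mul_ratioTilt {Ω : Type*} [MeasurableSpace Ω] (hrule : Measurable rule)
    {X : Fin k → ℕ → Ω → ℝ} {t : ℕ} (hX : ∀ i s, s ≤ t → Measurable (X i s)) (h : Fin k → ℝ)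
    (a : ℝ) : Measurable fun ω => a * (h (pulledArm σ rule (fun i s => X i s ω) t) /
      σ (pulledArm σ rule (fun i s => X i s ω) t) ^ 2) :=
  (measurable_ratioTilt hrule hX h).const_mul a

lemma measurable_ratioTilt_add_stoppedTilt {Ω : Type*} [MeasurableSpace Ω]
    (hrule : Measurable rule) {X : Fin k → ℕ → Ω → ℝ} {t : ℕ}
    (hX : ∀ i s, s ≤ t → Measurable (X i s)) (h : Fin k → ℝ) (m e η C : ℝ) (i : Fin k) :
    Measurable fun ω => h (pulledArm σ rule (fun i s => X i s ω) t) /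
      σ (pulledArm σ rule (fun i s => X i s ω) t) ^ 2 +
        stoppedTilt σ rule m e η C i (fun i s => X i s ω) t :=
  (measurable_ratioTilt hrule hX h).add (measurable_stoppedTilt hrule hX m e η C i)

variable {Ω : Type*} [MeasurableSpace Ω] {P : Measure Ω} [IsProbabilityMeasure P]
  {X : Fin k → ℕ → Ω → ℝ}

/-- Under the measure with means `μ + h`, a line is crossed with a small probability (the maximal
inequality for the exponential martingale). -/
lemma setLIntegral_crosses_le (hσ : ∀ i, 0 < σ i) (hrule : Measurable rule)
    (hX : IsRewardModel P μ σ X) (h : Fin k → ℝ) {e η C : ℝ} (he : e ^ 2 = 1) (hη : 0 < η)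
    (i : Fin k) (t : ℕ) :
    ∫⁻ ω in {ω | Crosses σ rule (μ i + h i) e η C i (fun i s => X i s ω) t},
        ENNReal.ofReal (Real.exp (logRatio μ σ rule h (fun i s => X i s ω) t)) ∂P ≤
      ENNReal.ofReal (Real.exp (-(η * C / σ i ^ 2))) := by
  have h1 := lintegral_exp_expSum (c := fun s ω =>
      h (pulledArm σ rule (fun i s => X i s ω) s) / σ (pulledArm σ rule (fun i s => X i s ω) s) ^ 2 +
        stoppedTilt σ rule (μ i + h i) e η C i (fun i s => X i s ω) s) hrule hX
    (fun s => @measurable_ratioTilt_add_stoppedTilt k σ rule Ω (history X s) hrule X s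
      (fun i r hr => measurable_history X hr i) h (μ i + h i) e η C i) t
  have h2 : ∀ ω, expSum μ σ rule (fun i s => X i s ω) (fun s =>
      h (pulledArm σ rule (fun i s => X i s ω) s) / σ (pulledArm σ rule (fun i s => X i s ω) s) ^ 2 +
        stoppedTilt σ rule (μ i + h i) e η C i (fun i s => X i s ω) s) t = _ :=
    fun ω => expSum_add hσ h (fun i s => X i s ω) _ t
  simp_rw [h2] at h1
  have hS := measurableSet_crosses (σ := σ) (t := t) hrule (fun i s _ => hX.measurable i s)
    (μ i + h i) e η C i
  calc _ = ∫⁻ ω in {ω | Crosses σ rule (μ i + h i) e η C i (fun i s => X i s ω) t},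
          ENNReal.ofReal (Real.exp (-(η * C / σ i ^ 2))) *
          ENNReal.ofReal (Real.exp (logRatio μ σ rule h (fun i s => X i s ω) t +
            η * C / σ i ^ 2)) ∂P := by
        refine lintegral_congr fun ω => ?_
        rw [← ENNReal.ofReal_mul (Real.exp_nonneg _), ← Real.exp_add]
        ring_nf
    _ ≤ ∫⁻ ω in {ω | Crosses σ rule (μ i + h i) e η C i (fun i s => X i s ω) t},
          ENNReal.ofReal (Real.exp (-(η * C / σ i ^ 2))) *
          ENNReal.ofReal (Real.exp (logRatio μ σ rule h (fun i s => X i s ω) t +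
            expSum (fun i => μ i + h i) σ rule (fun i s => X i s ω)
              (stoppedTilt σ rule (μ i + h i) e η C i (fun i s => X i s ω)) t)) ∂P := by
        refine setLIntegral_mono' hS fun ω hω => ?_
        gcongr
        exact le_expSum_stoppedTilt (μ := fun i => μ i + h i) hσ he hη i _ hω
    _ ≤ ∫⁻ ω, ENNReal.ofReal (Real.exp (-(η * C / σ i ^ 2))) *
          ENNReal.ofReal (Real.exp (logRatio μ σ rule h (fun i s => X i s ω) t +
            expSum (fun i => μ i + h i) σ rule (fun i s => X i s ω)
              (stoppedTilt σ rule (μ i + h i) e η C i (fun i s => X i s ω)) t)) ∂P :=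
        setLIntegral_le_lintegral _ _
    _ = ENNReal.ofReal (Real.exp (-(η * C / σ i ^ 2))) := by
        rw [lintegral_const_mul' _ _ ENNReal.ofReal_ne_top, h1, mul_one]

omit [IsProbabilityMeasure P] in
lemma measurable_logRatio (hrule : Measurable rule) (hX : IsRewardModel P μ σ X)
    (h : Fin k → ℝ) (t : ℕ) :
    Measurable fun ω => logRatio μ σ rule h (fun i s => X i s ω) t :=
  measurable_expSum hrule (fun i s _ => hX.measurable i s)
    fun _ _ => measurable_ratioTilt hrule (fun i s _ => hX.measurable i s) h

/-- The logarithm of the likelihood ratio is at most `V / 2 + 2 √V` with a large probability under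
the measure with means `μ + h`, where the information is at most `V`. -/
lemma setLIntegral_logRatio_le (hσ : ∀ i, 0 < σ i) (hrule : Measurable rule)
    (hX : IsRewardModel P μ σ X) (h : Fin k → ℝ) {V : ℝ} (hV : 0 < V) (t : ℕ) {S : Set Ω}
    (hS : MeasurableSet S)
    (hSV : ∀ ω ∈ S, ∑ i, pulls σ rule (fun i s => X i s ω) i t * (h i ^ 2 / σ i ^ 2) ≤ V ∧
      V / 2 + 2 * Real.sqrt V < logRatio μ σ rule h (fun i s => X i s ω) t) :
    ∫⁻ ω in S, ENNReal.ofReal (Real.exp (logRatio μ σ rule h (fun i s => X i s ω) t)) ∂P ≤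
      ENNReal.ofReal (1 / 4) := by
  set w := Real.sqrt V with hw
  have hw0 : 0 < w := Real.sqrt_pos.2 hV
  have hwV : w ^ 2 = V := Real.sq_sqrt hV.le
  have h1 := lintegral_exp_expSum (c := fun s ω => (1 + w⁻¹) *
      (h (pulledArm σ rule (fun i s => X i s ω) s) / σ (pulledArm σ rule (fun i s => X i s ω) s) ^ 2))
    hrule hX
    (fun s => @measurable_const_mul_ratioTilt k σ rule Ω (history X s) hrule X s
      (fun i r hr => measurable_history X hr i) h (1 + w⁻¹)) t
  have h2 : ∀ ω, expSum μ σ rule (fun i s => X i s ω) (fun s => (1 + w⁻¹) *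
      (h (pulledArm σ rule (fun i s => X i s ω) s) / σ (pulledArm σ rule (fun i s => X i s ω) s) ^ 2))
        t = _ :=
    fun ω => expSum_mul_ratio hσ h (fun i s => X i s ω) _ t
  simp_rw [h2] at h1
  have h3 : Real.exp (-(3 / 2)) ≤ 1 / 4 := by
    rw [Real.exp_neg, one_div]
    refine inv_anti₀ (by norm_num) ?_
    have := Real.quadratic_le_exp_of_nonneg (x := 3 / 2) (by norm_num)
    have h4 : Real.exp (3 / 2) = Real.exp (1 / 2) ^ 3 := by
      rw [← Real.exp_nat_mul]; norm_num
    have h5 := Real.quadratic_le_exp_of_nonneg (x := 1 / 2) (by norm_num)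
    rw [h4]
    calc (4 : ℝ) ≤ (1 + 1 / 2 + (1 / 2) ^ 2 / 2) ^ 3 := by norm_num
      _ ≤ _ := by gcongr
  calc _ ≤ ∫⁻ ω in S, ENNReal.ofReal (1 / 4) * ENNReal.ofReal (Real.exp
          ((1 + w⁻¹) * logRatio μ σ rule h (fun i s => X i s ω) t - (w⁻¹ + w⁻¹ ^ 2) / 2 *
            ∑ i, pulls σ rule (fun i s => X i s ω) i t * (h i ^ 2 / σ i ^ 2))) ∂P := by
        refine setLIntegral_mono' hS fun ω hω => ?_
        obtain ⟨ha, hb⟩ := hSV ω hω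
        rw [← ENNReal.ofReal_mul (by norm_num)]
        refine ENNReal.ofReal_le_ofReal ?_
        refine le_trans ?_ (mul_le_mul_of_nonneg_right h3 (Real.exp_nonneg _))
        rw [← Real.exp_add]
        refine Real.exp_le_exp.2 ?_
        have hv := mul_lt_mul_of_pos_left hb (inv_pos.2 hw0)
        have hv2 : w⁻¹ * (V / 2 + 2 * w) = w / 2 + 2 := by
          rw [← hwV]; field_simp
        have hv3 := mul_le_mul_of_nonneg_left ha (show 0 ≤ (w⁻¹ + w⁻¹ ^ 2) / 2 by positivity)
        have hv4 : (w⁻¹ + w⁻¹ ^ 2) / 2 * V = w / 2 + 1 / 2 := by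
          rw [← hwV]; field_simp
        linarith
    _ ≤ ∫⁻ ω, ENNReal.ofReal (1 / 4) * ENNReal.ofReal (Real.exp
          ((1 + w⁻¹) * logRatio μ σ rule h (fun i s => X i s ω) t - (w⁻¹ + w⁻¹ ^ 2) / 2 *
            ∑ i, pulls σ rule (fun i s => X i s ω) i t * (h i ^ 2 / σ i ^ 2))) ∂P :=
        setLIntegral_le_lintegral _ _
    _ = ENNReal.ofReal (1 / 4) := by
        rw [lintegral_const_mul' _ _ ENNReal.ofReal_ne_top, h1, mul_one]

variable (σ rule) in
/-- Within `t` rounds, the sample means of all arms stay close to `m`, uniformly in time. -/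
def Concentrated (m : Fin k → ℝ) (η C : ℝ) (x : Fin k → ℕ → ℝ) (t : ℕ) : Prop :=
  ∀ s ≤ t, ∀ i, |deviation σ rule x (m i) i s| ≤ η / 2 * pulls σ rule x i s + C

lemma not_concentrated_iff (m : Fin k → ℝ) (η C : ℝ) (x : Fin k → ℕ → ℝ) (t : ℕ) :
    ¬Concentrated σ rule m η C x t ↔
      ∃ i, Crosses σ rule (m i) 1 η C i x t ∨ Crosses σ rule (m i) (-1) η C i x t := by
  simp only [Concentrated, Crosses, not_forall, not_le, lt_abs, one_mul, neg_mul]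
  constructor
  · rintro ⟨s, hs, i, h | h⟩
    exacts [⟨i, Or.inl ⟨s, hs, h⟩⟩, ⟨i, Or.inr ⟨s, hs, h⟩⟩]
  · rintro ⟨i, ⟨s, hs, h⟩ | ⟨s, hs, h⟩⟩
    exacts [⟨s, hs, i, Or.inl h⟩, ⟨s, hs, i, Or.inr h⟩]

/-- If a wrong arm is recommended on every path whose sample means stay close to `μ + h`, and the
information about `h` is at most `V` on these paths, then the probability of error is at least
`exp (-V / 2 - 2 √V) / 4`. -/
theorem le_probError [NeZero k] (hσ : ∀ i, 0 < σ i) (hrule : Measurable rule)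
    (hX : IsRewardModel P μ σ X) (recom : (Fin k → ℝ) → Fin k) (b : Fin k)
    (h : Fin k → ℝ) {η C V : ℝ} (hη : 0 < η) (hV : 0 < V)
    (hC : ∀ i, Real.exp (-(η * C / σ i ^ 2)) ≤ 1 / (4 * k)) (t : ℕ)
    (hgood : ∀ x, Concentrated σ rule (fun i => μ i + h i) η C x t →
      recommended σ rule recom x t ≠ b ∧
        ∑ i, pulls σ rule x i t * (h i ^ 2 / σ i ^ 2) ≤ V) :
    1 / 4 * Real.exp (-(V / 2 + 2 * Real.sqrt V)) ≤ probError P σ rule recom X b t := by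
  have hk : (0 : ℝ) < k := by exact_mod_cast Nat.pos_of_ne_zero (NeZero.ne k)
  set v := V / 2 + 2 * Real.sqrt V with hv
  let F : Ω → ℝ≥0∞ := fun ω =>
    ENNReal.ofReal (Real.exp (logRatio μ σ rule h (fun i s => X i s ω) t))
  let G : Set Ω := {ω | Concentrated σ rule (fun i => μ i + h i) η C (fun i s => X i s ω) t}
  let U : Set Ω := {ω | v < logRatio μ σ rule h (fun i s => X i s ω) t}
  have hU : MeasurableSet U :=
    measurableSet_lt measurable_const (measurable_logRatio hrule hX h t)
  have hGc : Gᶜ = ⋃ i, ({ω | Crosses σ rule (μ i + h i) 1 η C i (fun i s => X i s ω) t} ∪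
      {ω | Crosses σ rule (μ i + h i) (-1) η C i (fun i s => X i s ω) t}) := by
    ext ω
    simpa [G] using not_concentrated_iff (σ := σ) (rule := rule) (fun i => μ i + h i) η C
      (fun i s => X i s ω) t
  have hG : MeasurableSet G := by
    rw [← MeasurableSet.compl_iff, hGc]
    exact MeasurableSet.iUnion fun i =>
      (measurableSet_crosses hrule (fun i s _ => hX.measurable i s) _ _ _ _ i).union
        (measurableSet_crosses hrule (fun i s _ => hX.measurable i s) _ _ _ _ i)
  have hF : ∫⁻ ω, F ω ∂P = 1 := lintegral_exp_expSum hrule hX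
    (fun s => @measurable_ratioTilt k σ rule Ω (history X s) hrule X s
        (fun i r hr => measurable_history X hr i) h) t
  have h1 : ∫⁻ ω in Gᶜ, F ω ∂P ≤ ENNReal.ofReal (1 / 2) := by
    calc ∫⁻ ω in Gᶜ, F ω ∂P ≤ ∑ i, ∫⁻ ω in
          ({ω | Crosses σ rule (μ i + h i) 1 η C i (fun i s => X i s ω) t} ∪
            {ω | Crosses σ rule (μ i + h i) (-1) η C i (fun i s => X i s ω) t}), F ω ∂P := by
          rw [hGc, ← tsum_fintype (L := .unconditional _)]
          exact lintegral_iUnion_le _ _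
      _ ≤ ∑ _i : Fin k, (ENNReal.ofReal (1 / (4 * k)) + ENNReal.ofReal (1 / (4 * k))) := by
          refine Finset.sum_le_sum fun i _ => (lintegral_union_le _ _ _).trans (add_le_add ?_ ?_)
          · exact (setLIntegral_crosses_le hσ hrule hX h (by norm_num) hη i t).trans
              (ENNReal.ofReal_le_ofReal (hC i))
          · exact (setLIntegral_crosses_le hσ hrule hX h (by norm_num) hη i t).trans
              (ENNReal.ofReal_le_ofReal (hC i))
      _ = ENNReal.ofReal (1 / 2) := by
          rw [← ENNReal.ofReal_add (by positivity) (by positivity), Finset.sum_const,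
            Finset.card_univ, Fintype.card_fin, nsmul_eq_mul, ← ENNReal.ofReal_natCast,
            ← ENNReal.ofReal_mul hk.le]
          congr 1
          field_simp
          norm_num
  have h2 : ∫⁻ ω in G ∩ U, F ω ∂P ≤ ENNReal.ofReal (1 / 4) :=
    setLIntegral_logRatio_le hσ hrule hX h hV t (hG.inter hU) fun ω hω => ⟨(hgood _ hω.1).2, hω.2⟩
  have h3 : ∫⁻ ω in G \ U, F ω ∂P ≤ ENNReal.ofReal (Real.exp v) * P G := by
    calc ∫⁻ ω in G \ U, F ω ∂P ≤ ∫⁻ _ω in G \ U, ENNReal.ofReal (Real.exp v) ∂P := by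
          refine setLIntegral_mono' (hG.diff hU) fun ω hω => ?_
          exact ENNReal.ofReal_le_ofReal (Real.exp_le_exp.2 (not_lt.1 hω.2))
      _ = ENNReal.ofReal (Real.exp v) * P (G \ U) := setLIntegral_const _ _
      _ ≤ _ := by gcongr; exact Set.sdiff_subset
  have h4 : (1 : ℝ≥0∞) ≤ ENNReal.ofReal (1 / 4) + ENNReal.ofReal (Real.exp v) * P G +
      ENNReal.ofReal (1 / 2) := by
    rw [← hF, ← lintegral_add_compl _ hG, ← lintegral_inter_add_sdiff F G hU]
    gcongr
  have h5 : (1 : ℝ) ≤ 1 / 4 + Real.exp v * P.real G + 1 / 2 := by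
    rw [← ofReal_measureReal (μ := P) (s := G), ← ENNReal.ofReal_mul (Real.exp_nonneg _),
      ← ENNReal.ofReal_add (by norm_num) (by positivity),
      ← ENNReal.ofReal_add (by positivity) (by norm_num), ENNReal.one_le_ofReal] at h4
    exact h4
  have h6 : P.real G ≤ probError P σ rule recom X b t :=
    measureReal_mono fun ω hω => (hgood _ hω).1
  refine le_trans ?_ h6
  rw [Real.exp_neg, ← div_eq_mul_inv, div_le_iff₀ (Real.exp_pos v)]
  linarith

end ChangeOfMeasure

/-! ### Allocation of the pulls when two arms are tied for the best one -/

open Finset in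
lemma exists_sigma_bounds {k : ℕ} {σ : Fin k → ℝ} (hσ : ∀ i, 0 < σ i) :
    ∃ lo hi : ℝ, 0 < lo ∧ 0 < hi ∧ ∀ i, lo ≤ σ i ∧ σ i ≤ hi := by
  have h1 : ∃ lo : ℝ, 0 < lo ∧ ∀ i, lo ≤ σ i := by
    rcases isEmpty_or_nonempty (Fin k) with h | h
    · exact ⟨1, one_pos, fun i => h.elim i⟩
    · obtain ⟨i, hi⟩ := Finite.exists_min σ
      exact ⟨σ i, hσ i, hi⟩
  obtain ⟨lo, hlo, h1⟩ := h1
  refine ⟨lo, lo + ∑ i, σ i, hlo, add_pos_of_pos_of_nonneg hlo (sum_nonneg fun i _ => (hσ i).le),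
    fun i => ⟨h1 i, ?_⟩⟩
  have := single_le_sum (f := σ) (fun j _ => (hσ j).le) (mem_univ i)
  linarith

section Allocation

variable {k : ℕ} {σ : Fin k → ℝ} {rule : Knowledge k → Fin k}

lemma zeta_le {s : ℝ} (hs : 0 < s) {n : ℕ} (hn : n ≠ 0) : zeta s n ≤ s / n := by
  have hn' : (0 : ℝ) < n := by exact_mod_cast Nat.pos_of_ne_zero hn
  rw [zeta]
  refine div_le_div_of_nonneg_left hs.le hn' (Real.le_sqrt_of_sq_le ?_)
  nlinarith

lemma le_zeta {s : ℝ} (hs : 0 < s) {n : ℕ} (hn : n ≠ 0) : s / (n + 1) ≤ zeta s n := by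
  have hn' : (0 : ℝ) < n := by exact_mod_cast Nat.pos_of_ne_zero hn
  rw [zeta]
  refine div_le_div_of_nonneg_left hs.le (by positivity) (Real.sqrt_le_iff.2 ⟨by positivity, ?_⟩)
  nlinarith

lemma Concentrated.abs_mean_sub_le (hσ : ∀ i, 0 < σ i) {m : Fin k → ℝ} {η C : ℝ}
    {x : Fin k → ℕ → ℝ} {t : ℕ} (h : Concentrated σ rule m η C x t) {s : ℕ} (hs : s ≤ t)
    {i : Fin k} (hi : pulls σ rule x i s ≠ 0) :
    |mean σ rule x s i - m i| ≤ η / 2 + C / pulls σ rule x i s := by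
  have hn : (0 : ℝ) < pulls σ rule x i s := by exact_mod_cast Nat.pos_of_ne_zero hi
  have h1 := h s hs i
  rw [← pulls_mul_mean_sub σ rule x hσ, abs_mul, abs_of_pos hn, mul_comm, ← le_div_iff₀ hn,
    add_div, mul_div_cancel_right₀ _ hn.ne'] at h1
  exact h1

/-- If the posterior means remain bounded, then every arm is pulled arbitrarily often: the knowledge
gradient value of an arm with few pulls is bounded away from zero, whereas it vanishes for the arms
with many pulls. -/
lemma exists_forall_le_pulls (hk : 2 ≤ k) (hσ : ∀ i, 0 < σ i) (hrule : IsKGRule σ rule) {B : ℝ}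
    (hB : 0 ≤ B) (N : ℕ) :
    ∃ T : ℕ, ∀ (x : Fin k → ℕ → ℝ) (t : ℕ),
      (∀ s ≤ t, ∀ i, pulls σ rule x i s ≠ 0 → |mean σ rule x s i| ≤ B) →
      ∀ s, T ≤ s → s ≤ t → ∀ c, N ≤ pulls σ rule x c s := by
  obtain ⟨lo, hi, hlo, hhi, hb⟩ := exists_sigma_bounds hσ
  set z : ℝ := lo / (N + 1) with hz
  have hz0 : 0 < z := by positivity
  set v : ℝ := z * f (-(2 * B / z)) with hv
  have hv0 : 0 < v := mul_pos hz0 (f_pos _)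
  obtain ⟨M, hM⟩ := exists_nat_gt (hi * f 0 / v)
  have hM0 : (0 : ℝ) < M := lt_of_le_of_lt (div_nonneg (mul_nonneg hhi.le (f_pos 0).le) hv0.le) hM
  have hM1 : M ≠ 0 := by rintro rfl; simp at hM0
  refine ⟨k * M + 1, fun x t hmean s hTs hst c => ?_⟩
  by_contra! hc
  have h1 : ∃ i, M < pulls σ rule x i s := by
    by_contra! h
    have h2 := Finset.sum_le_sum fun i (_ : i ∈ Finset.univ) => h i
    rw [sum_pulls] at h2
    simp at h2
    omega
  obtain ⟨i, hi'⟩ := h1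
  obtain ⟨r, hrs, hr, hrM⟩ := exists_pull σ rule x hi'
  have hspec := pulledArm_spec x hσ hrule hr (by rw [hrM]; exact hM1)
  obtain ⟨hc0, hle⟩ := hspec c
  have hcN : pulls σ rule x c r ≤ N := (pulls_mono σ rule x c hrs.le).trans hc.le
  have hm : ∀ j, |mean σ rule x r j| ≤ B := fun j => hmean r (by omega) j (hspec j).1
  have hgap : gap σ rule x r c ≤ 2 * B := by
    obtain ⟨j, _, hj⟩ := exists_maxOther_eq hk (mean σ rule x r) c
    rw [gap, hj]
    exact (abs_sub _ _).trans (by linarith [hm c, hm j])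
  have hzc : z ≤ zeta (σ c) (pulls σ rule x c r) := by
    refine le_trans ?_ (le_zeta (hσ c) hc0)
    rw [hz]
    have hcN' : (pulls σ rule x c r : ℝ) ≤ N := by exact_mod_cast hcN
    exact div_le_div₀ (hσ c).le (hb c).1 (by positivity) (by linarith)
  have hlow : v ≤ zeta (σ c) (pulls σ rule x c r) *
      f (-(gap σ rule x r c / zeta (σ c) (pulls σ rule x c r))) := by
    rw [hv]
    have h2 : gap σ rule x r c / zeta (σ c) (pulls σ rule x c r) ≤ 2 * B / z :=
      div_le_div₀ (by positivity) hgap hz0 hzc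
    exact mul_le_mul hzc (f_mono (neg_le_neg h2)) (f_pos _).le (hz0.le.trans hzc)
  have hi0 : pulls σ rule x i r ≠ 0 := (hspec i).1
  have hup : zeta (σ i) (pulls σ rule x i r) *
      f (-(gap σ rule x r i / zeta (σ i) (pulls σ rule x i r))) ≤ hi / M * f 0 := by
    have h2 : zeta (σ i) (pulls σ rule x i r) ≤ hi / M := by
      refine (zeta_le (hσ i) hi0).trans ?_
      rw [hrM]
      have := (hb i).2
      gcongr
    refine mul_le_mul h2 (f_mono ?_) (f_pos _).le (by positivity)
    rw [neg_nonpos]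
    exact div_nonneg (abs_nonneg _) (zeta_pos (hσ i) hi0).le
  have h3 : hi / M * f 0 < v := by
    rw [div_mul_eq_mul_div, div_lt_iff₀ hM0, mul_comm v]
    exact (div_lt_iff₀ hv0).1 hM
  linarith

/-- When the posterior means of `a` and `a'` nearly coincide and the other arms are worse by at
least `1`, an arm other than `a` and `a'` with a fraction `ε` of the pulls is not pulled. -/
lemma exists_forall_pulledArm_ne (hσ : ∀ i, 0 < σ i) (hrule : IsKGRule σ rule) {lo hi : ℝ}
    (hlo : 0 < lo) (hhi : 0 < hi) (hb : ∀ i, lo ≤ σ i ∧ σ i ≤ hi) {ε η : ℝ} (hε : 0 < ε)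
    (hηε : 96 * η * hi ≤ ε * lo) :
    ∃ T : ℕ, ∀ (x : Fin k → ℕ → ℝ) (s : ℕ) (a i : Fin k), T ≤ s → gap σ rule x s a ≤ 6 * η →
      1 ≤ gap σ rule x s i → ε * s ≤ pulls σ rule x i s → pulledArm σ rule x s ≠ i := by
  obtain ⟨Y, hY0, hY⟩ := exists_mul_f_neg_lt (2 * hi / (ε * lo))
  obtain ⟨T, hT⟩ := exists_nat_gt (hi * (Y + 16) / ε)
  refine ⟨T + 1, fun x s a i hTs hga hgi hpi hpull => ?_⟩
  have hs1 : (1 : ℝ) ≤ s := by exact_mod_cast (by omega : 1 ≤ s)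
  have hsT : hi * (Y + 16) / ε < s := hT.trans_le (by exact_mod_cast (by omega : T ≤ s))
  have hεs : hi * (Y + 16) < ε * s := by
    rw [div_lt_iff₀ hε] at hsT; linarith
  have hi0 : pulls σ rule x i s ≠ 0 := by
    intro h0
    rw [h0] at hpi
    have : 0 < ε * s := by positivity
    simp at hpi
    linarith
  have hni : (0 : ℝ) < pulls σ rule x i s := by exact_mod_cast Nat.pos_of_ne_zero hi0
  obtain ⟨ha0, hle⟩ := pulledArm_spec x hσ hrule hpull hi0 a
  have hna : (pulls σ rule x a s : ℝ) ≤ s := by exact_mod_cast pulls_le σ rule x a s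
  have hza0 := zeta_pos (hσ a) ha0
  have hzi0 := zeta_pos (hσ i) hi0
  have hga0 : 0 ≤ gap σ rule x s a := abs_nonneg _
  have hza : lo / (2 * s) ≤ zeta (σ a) (pulls σ rule x a s) := by
    refine le_trans ?_ (le_zeta (hσ a) ha0)
    exact div_le_div₀ (hσ a).le (hb a).1 (by positivity) (by linarith)
  have hzi : zeta (σ i) (pulls σ rule x i s) ≤ hi / (ε * s) :=
    (zeta_le (hσ i) hi0).trans (div_le_div₀ hhi.le (hb i).2 (by positivity) hpi)
  set y := gap σ rule x s i / zeta (σ i) (pulls σ rule x i s) with hy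
  set w := gap σ rule x s a / zeta (σ a) (pulls σ rule x a s) with hw
  have hyl : ε * s / hi ≤ y := by
    rw [hy, le_div_iff₀ hzi0]
    calc ε * s / hi * zeta (σ i) (pulls σ rule x i s) ≤ ε * s / hi * (hi / (ε * s)) := by gcongr
      _ = 1 := by field_simp
      _ ≤ _ := hgi
  have hwu : w ≤ ε * s / hi / 8 := by
    rw [hw, div_le_iff₀ hza0]
    calc gap σ rule x s a ≤ 6 * η := hga
      _ ≤ ε * s / hi / 8 * (lo / (2 * s)) := by
        have : ε * s / hi / 8 * (lo / (2 * s)) = ε * lo / (16 * hi) := by field_simp; norm_num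
        rw [this, le_div_iff₀ (by positivity)]
        linarith
      _ ≤ _ := by gcongr
  have hbig : Y + 16 ≤ ε * s / hi := by
    rw [le_div_iff₀ hhi]; linarith
  have hkey := hY y (by linarith) w (div_nonneg hga0 hza0.le) (by linarith)
  have hR : zeta (σ i) (pulls σ rule x i s) ≤
      2 * hi / (ε * lo) * zeta (σ a) (pulls σ rule x a s) := by
    refine hzi.trans ?_
    calc hi / (ε * s) = 2 * hi / (ε * lo) * (lo / (2 * s)) := by field_simp
      _ ≤ _ := by gcongr
  have h1 := mul_le_mul_of_nonneg_right hR (f_pos (-y)).le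
  have h2 := mul_lt_mul_of_pos_left hkey hza0
  have h3 : 2 * hi / (ε * lo) * zeta (σ a) (pulls σ rule x a s) * f (-y) =
    zeta (σ a) (pulls σ rule x a s) * (2 * hi / (ε * lo) * f (-y)) := by ring
  linarith

/-- The means of an instance in which `a'` is slightly better than `a`, and all other arms are worse
by about `1`. -/
def tiedMeans (a a' : Fin k) (l η : ℝ) (i : Fin k) : ℝ :=
  if i = a then l - 2 * η else if i = a' then l + 2 * η else l - 1

lemma tiedMeans_of_ne {a a' i : Fin k} (ha : i ≠ a) (ha' : i ≠ a') (l η : ℝ) :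
    tiedMeans a a' l η i = l - 1 := by
  simp [tiedMeans, ha, ha']

lemma tiedMeans_left (a a' : Fin k) (l η : ℝ) : tiedMeans a a' l η a = l - 2 * η := by
  simp [tiedMeans]

lemma tiedMeans_right {a a' : Fin k} (h : a ≠ a') (l η : ℝ) :
    tiedMeans a a' l η a' = l + 2 * η := by
  simp [tiedMeans, h.symm]

section Tied

variable {a a' : Fin k} {l η : ℝ} {x : Fin k → ℕ → ℝ} {s : ℕ}

lemma mean_lt_of_tied (haa : a ≠ a') (hη : 0 < η) (hη' : η ≤ 1 / 16)
    (hm : ∀ i, |mean σ rule x s i - tiedMeans a a' l η i| ≤ η) {i : Fin k} (hi : i ≠ a') :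
    mean σ rule x s i < mean σ rule x s a' := by
  have h1 := abs_le.1 (hm i)
  have h2 := abs_le.1 (hm a')
  rw [tiedMeans_right haa] at h2
  by_cases hia : i = a
  · subst hia
    rw [tiedMeans_left] at h1
    linarith
  · rw [tiedMeans_of_ne hia hi] at h1
    linarith

lemma gap_le_of_tied (hk : 2 ≤ k) (haa : a ≠ a') (hη : 0 < η) (hη' : η ≤ 1 / 16)
    (hm : ∀ i, |mean σ rule x s i - tiedMeans a a' l η i| ≤ η) : gap σ rule x s a ≤ 6 * η := by
  have h0 := abs_le.1 (hm a)
  have h2 := abs_le.1 (hm a')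
  rw [tiedMeans_right haa] at h2
  rw [tiedMeans_left] at h0
  obtain ⟨j, hja, hj⟩ := exists_maxOther_eq hk (mean σ rule x s) a
  have h3 := le_maxOther (mean σ rule x s) haa.symm
  have h4 : mean σ rule x s j ≤ mean σ rule x s a' := by
    by_cases h : j = a'
    · rw [h]
    · exact (mean_lt_of_tied haa hη hη' hm h).le
  rw [gap, abs_le]
  constructor <;> linarith

lemma le_gap_of_tied (haa : a ≠ a')
    (hm : ∀ i, |mean σ rule x s i - tiedMeans a a' l η i| ≤ η) {i : Fin k} (hia : i ≠ a)
    (hia' : i ≠ a') : 1 ≤ gap σ rule x s i := by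
  have h0 := abs_le.1 (hm i)
  have h2 := abs_le.1 (hm a')
  rw [tiedMeans_right haa] at h2
  rw [tiedMeans_of_ne hia hia'] at h0
  have h3 := le_maxOther (mean σ rule x s) hia'.symm
  rw [gap, abs_sub_comm]
  refine le_trans ?_ (le_abs_self _)
  linarith

end Tied

/-- On the paths whose sample means stay close to the means of an instance in which `a` and `a'` are
nearly tied, the largest posterior mean is eventually that of `a'`, and the arms other than `a` and
`a'` receive only a small fraction of the pulls. -/
lemma exists_forall_concentrated_tied (hk : 2 ≤ k) (hσ : ∀ i, 0 < σ i) (hrule : IsKGRule σ rule)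
    {lo hi : ℝ} (hlo : 0 < lo) (hhi : 0 < hi) (hb : ∀ i, lo ≤ σ i ∧ σ i ≤ hi) {a a' : Fin k}
    (haa : a ≠ a') (l : ℝ) {ε η C : ℝ} (hε : 0 < ε) (hη : 0 < η) (hη' : η ≤ 1 / 16)
    (hηε : 96 * η * hi ≤ ε * lo) (hC : 0 ≤ C) :
    ∃ T : ℕ, ∀ (x : Fin k → ℕ → ℝ) (t : ℕ), T ≤ t →
      Concentrated σ rule (tiedMeans a a' l η) η C x t →
      (∀ i, i ≠ a' → mean σ rule x t i < mean σ rule x t a') ∧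
      ∀ i, i ≠ a → i ≠ a' → (pulls σ rule x i t : ℝ) ≤ ε * t + T := by
  obtain ⟨N, hN⟩ := exists_nat_gt (2 * C / η)
  have hN0 : (0 : ℝ) < N := lt_of_le_of_lt (by positivity) hN
  obtain ⟨T₁, hT₁⟩ := exists_forall_le_pulls hk hσ hrule
    (B := |l| + 2 + η / 2 + C) (by positivity) N
  obtain ⟨T₂, hT₂⟩ := exists_forall_pulledArm_ne hσ hrule hlo hhi hb hε hηε
  refine ⟨T₁ + T₂ + 2, fun x t htT hconc => ?_⟩
  have hbound : ∀ s ≤ t, ∀ i, pulls σ rule x i s ≠ 0 →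
      |mean σ rule x s i| ≤ |l| + 2 + η / 2 + C := by
    intro s hs i hi
    have h1 := hconc.abs_mean_sub_le hσ hs hi
    have hn : (1 : ℝ) ≤ pulls σ rule x i s := by exact_mod_cast Nat.pos_of_ne_zero hi
    have h2 : C / pulls σ rule x i s ≤ C := div_le_self hC hn
    have h3 : |tiedMeans a a' l η i| ≤ |l| + 2 := by
      have hl := abs_le.1 (le_refl |l|)
      rw [abs_le]
      unfold tiedMeans
      split_ifs <;> constructor <;> linarith
    have h4 := abs_sub_abs_le_abs_sub (mean σ rule x s i) (tiedMeans a a' l η i)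
    linarith
  have hclose : ∀ s, T₁ ≤ s → s ≤ t → ∀ i, |mean σ rule x s i - tiedMeans a a' l η i| ≤ η := by
    intro s hTs hst i
    have hNi : (N : ℝ) ≤ pulls σ rule x i s := by exact_mod_cast hT₁ x t hbound s hTs hst i
    have hi0 : pulls σ rule x i s ≠ 0 := by
      intro h0; rw [h0, Nat.cast_zero] at hNi; linarith
    refine (hconc.abs_mean_sub_le hσ hst hi0).trans ?_
    have h1 : C / pulls σ rule x i s ≤ η / 2 := by
      rw [div_le_iff₀ (by linarith)]
      rw [div_lt_iff₀ hη] at hN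
      nlinarith
    linarith
  refine ⟨fun i hi => mean_lt_of_tied haa hη hη' (hclose t (by omega) le_rfl) hi,
    fun i hia hia' => ?_⟩
  by_contra! hlt
  -- the last pull of arm `i` happens in a late round in which it should not be pulled
  have hpos : 0 < pulls σ rule x i t := by
    have : (0 : ℝ) < pulls σ rule x i t := lt_of_le_of_lt (by positivity) hlt
    exact_mod_cast this
  obtain ⟨s, hst, hpull, hm⟩ := exists_pull σ rule x (i := i) (t := t)
    (m := pulls σ rule x i t - 1) (by omega)
  have hm' : (pulls σ rule x i s : ℝ) = pulls σ rule x i t - 1 := by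
    rw [hm, Nat.cast_sub (by omega), Nat.cast_one]
  push_cast at hlt
  have hεt : ε * s ≤ ε * t := by
    have : (s : ℝ) ≤ t := by exact_mod_cast hst.le
    gcongr
  have hsT : T₁ + T₂ ≤ s := by
    have h1 : (pulls σ rule x i s : ℝ) ≤ s := by exact_mod_cast pulls_le σ rule x i s
    have h2 : 0 ≤ ε * t := by positivity
    have : ((T₁ + T₂ : ℕ) : ℝ) ≤ s := by push_cast; linarith
    exact_mod_cast this
  have hcl := hclose s (by omega) hst.le
  exact hT₂ x s a i (by omega) (gap_le_of_tied hk haa hη hη' hcl)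
    (le_gap_of_tied haa hcl hia hia')
    (by rw [hm']; have : (0 : ℝ) ≤ T₁ := by positivity
        have : (0 : ℝ) ≤ T₂ := by positivity
        linarith) hpull

end Allocation

section TiedBound

variable {k : ℕ} {μ σ : Fin k → ℝ} {rule : Knowledge k → Fin k}
  {Ω : Type*} [MeasurableSpace Ω] {P : Measure Ω} [IsProbabilityMeasure P]
  {X : Fin k → ℕ → Ω → ℝ}

lemma abs_level_sub {s s' : ℝ} (hs : 0 < s) (hs' : 0 < s') (m m' : ℝ) :
    |(s' * m + s * m') / (s + s') - m| = |m - m'| / (s + s') * s := by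
  have h : (s' * m + s * m') / (s + s') - m = -((m - m') / (s + s') * s) := by
    field_simp
    ring
  rw [h, abs_neg, abs_mul, abs_div, abs_of_pos hs, abs_of_pos (add_pos hs hs')]

lemma sq_div_sq_le {lo s d lam η : ℝ} (hlo : 0 < lo) (hη : 0 ≤ η) (hs : lo ≤ s)
    (hd : |d| ≤ lam * s + 2 * η) : d ^ 2 / s ^ 2 ≤ (lam + 2 * η / lo) ^ 2 := by
  have hs0 : 0 < s := hlo.trans_le hs
  rw [← sq_abs d, ← div_pow]
  refine pow_le_pow_left₀ (by positivity) ?_ 2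
  rw [div_le_iff₀ hs0, add_mul]
  have : 2 * η ≤ 2 * η / lo * s := by
    rw [div_mul_eq_mul_div, le_div_iff₀ hlo]
    gcongr
  linarith

/-- At the common level, each of the two arms is shifted by the same number of standard
deviations. -/
lemma abs_tiedMeans_sub_le (hσ : ∀ i, 0 < σ i) {a a' : Fin k} (haa : a ≠ a') {η : ℝ}
    (hη : 0 ≤ η) {i : Fin k} (hi : i = a ∨ i = a') :
    |tiedMeans a a' ((σ a' * μ a + σ a * μ a') / (σ a + σ a')) η i - μ i| ≤
      |μ a - μ a'| / (σ a + σ a') * σ i + 2 * η := by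
  set l := (σ a' * μ a + σ a * μ a') / (σ a + σ a') with hl
  rcases hi with rfl | rfl
  · have h1 := abs_level_sub (hσ i) (hσ a') (μ i) (μ a')
    rw [← hl] at h1
    rw [tiedMeans_left, ← h1, abs_le]
    have := abs_le.1 (le_refl |l - μ i|)
    constructor <;> linarith
  · have h1 := abs_level_sub (hσ i) (hσ a) (μ i) (μ a)
    rw [abs_sub_comm (μ i), add_comm (σ i) (σ a), add_comm (σ a * _), ← hl] at h1
    rw [tiedMeans_right haa, ← h1, abs_le]
    have := abs_le.1 (le_refl |l - μ i|)
    constructor <;> linarith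

/-- The intercept for which a line is crossed with probability at most `1 / (4 k)`. -/
lemma exp_neg_intercept_le [NeZero k] (hσ : ∀ i, 0 < σ i) {hi : ℝ} (hb : ∀ i, σ i ≤ hi) {η C : ℝ}
    (hC : hi ^ 2 * Real.log (4 * k) ≤ η * C) (i : Fin k) :
    Real.exp (-(η * C / σ i ^ 2)) ≤ 1 / (4 * k) := by
  have hk : (1 : ℝ) ≤ k := by exact_mod_cast Nat.pos_of_ne_zero (NeZero.ne k)
  have hlog : 0 ≤ Real.log (4 * k) := Real.log_nonneg (by linarith)
  rw [one_div, ← Real.exp_log (show (0 : ℝ) < (4 * k) by positivity), ← Real.exp_neg]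
  refine Real.exp_le_exp.2 (neg_le_neg ?_)
  rw [le_div_iff₀ (pow_pos (hσ i) 2), mul_comm]
  refine le_trans ?_ hC
  have := hb i
  have := (hσ i).le
  gcongr

/-- Two arms `a` and `a'`, where `a' ≠ b` but possibly `a = b`, can be brought to a common level
by a shift of `λ` standard deviations each, and then the other arms are hardly pulled, so the
probability of error decays at most at the exponential rate `λ² / 2`. -/
theorem exists_le_probError_of_pair (hk : 2 ≤ k) (hσ : ∀ i, 0 < σ i) (hrule : IsKGRule σ rule)
    (hX : IsRewardModel P μ σ X) {recom : (Fin k → ℝ) → Fin k} (hrecom : IsRecommendation recom)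
    {b a a' : Fin k} (haa : a ≠ a') (hab : a' ≠ b) {κ : ℝ} (hκ : 0 < κ) :
    ∃ (C : ℝ) (T : ℕ), 0 < C ∧ ∀ t : ℕ, T ≤ t → ∀ V,
      V = ((|μ a - μ a'| / (σ a + σ a')) ^ 2 + κ) * t + C →
      1 / 4 * Real.exp (-(V / 2 + 2 * Real.sqrt V)) ≤ probError P σ rule recom X b t := by
  have : NeZero k := ⟨by omega⟩
  have hk0 : (1 : ℝ) ≤ k := by exact_mod_cast (by omega : 1 ≤ k)
  obtain ⟨lo, hi, hlo, hhi, hb⟩ := exists_sigma_bounds hσ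
  have hσa := hσ a
  have hσa' := hσ a'
  set lam := |μ a - μ a'| / (σ a + σ a')
  have hlam0 : 0 ≤ lam := by positivity
  -- the common level that both arms reach by a shift of `λ` standard deviations
  set l := (σ a' * μ a + σ a * μ a') / (σ a + σ a')
  obtain ⟨H, hH0, hH⟩ : ∃ H : ℝ, 0 ≤ H ∧ ∀ i, (l - 1 - μ i) ^ 2 / σ i ^ 2 ≤ H :=
    ⟨∑ i, (l - 1 - μ i) ^ 2 / σ i ^ 2, Finset.sum_nonneg fun i _ => by positivity, fun i =>
      Finset.single_le_sum (f := fun i => (l - 1 - μ i) ^ 2 / σ i ^ 2)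
        (fun j _ => by positivity) (Finset.mem_univ i)⟩
  set ε := κ / (2 * k * (H + 1)) with hε
  have hε0 : 0 < ε := by positivity
  have hεH : k * ε * H ≤ κ / 2 := by
    rw [hε]
    calc k * (κ / (2 * k * (H + 1))) * H = κ / 2 * (H / (H + 1)) := by field_simp
      _ ≤ κ / 2 * 1 := by
        gcongr
        rw [div_le_one (by positivity)]
        linarith
      _ = κ / 2 := mul_one _
  set η := min (1 / 16) (min (ε * lo / (96 * hi)) (min (lo / 2) (κ * lo / (4 * lam + 2) / 2)))
    with hη
  have hη0 : 0 < η := by positivity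
  have hη1 : η ≤ 1 / 16 := min_le_left _ _
  have hη2 : η ≤ ε * lo / (96 * hi) := (min_le_right _ _).trans (min_le_left _ _)
  have hη3 : η ≤ lo / 2 := (min_le_right _ _).trans ((min_le_right _ _).trans (min_le_left _ _))
  have hη4 : η ≤ κ * lo / (4 * lam + 2) / 2 :=
    (min_le_right _ _).trans ((min_le_right _ _).trans (min_le_right _ _))
  have hηε : 96 * η * hi ≤ ε * lo := by
    rw [le_div_iff₀ (by positivity)] at hη2
    linarith
  have hsq : (lam + 2 * η / lo) ^ 2 ≤ lam ^ 2 + κ / 2 := by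
    have h1 : 2 * η / lo ≤ 1 := by rw [div_le_one hlo]; linarith
    have h2 : 2 * η / lo * (2 * lam + 1) ≤ κ / 2 := by
      rw [le_div_iff₀ two_pos, le_div_iff₀ (by positivity)] at hη4
      rw [div_mul_eq_mul_div, div_le_iff₀ hlo]
      nlinarith
    have h3 : 0 ≤ 2 * η / lo := by positivity
    nlinarith
  set C := hi ^ 2 * Real.log (4 * k) / η with hC
  have hC0 : 0 ≤ C := by
    have := Real.log_nonneg (show (1 : ℝ) ≤ 4 * k by linarith)
    positivity
  obtain ⟨T, hT⟩ := exists_forall_concentrated_tied hk hσ hrule hlo hhi hb haa l hε0 hη0 hη1 hηε hC0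
  refine ⟨k * (T * H) + 1, T, by positivity, fun t ht V hV => ?_⟩
  have hV0 : 0 < V := by rw [hV]; positivity
  refine le_probError hσ hrule.measurable hX recom b (fun i => tiedMeans a a' l η i - μ i) hη0 hV0
    (C := C) (exp_neg_intercept_le hσ (fun i => (hb i).2) (mul_div_cancel₀ _ hη0.ne').ge) t
    fun x hx => ?_
  have hx' : Concentrated σ rule (tiedMeans a a' l η) η C x t := by
    simpa using hx
  obtain ⟨hbest, hpulls⟩ := hT x t ht hx'
  constructor
  · intro hJ
    have h1 := hrecom.isMax (knowledge σ rule x t).1 a'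
    rw [show recom (knowledge σ rule x t).1 = b from hJ] at h1
    exact absurd (hbest b hab.symm) (not_lt.2 h1)
  · have hpair : ∀ i, i = a ∨ i = a' →
        (tiedMeans a a' l η i - μ i) ^ 2 / σ i ^ 2 ≤ lam ^ 2 + κ / 2 := by
      intro i hi
      exact (sq_div_sq_le hlo hη0.le (hb i).1
        (abs_tiedMeans_sub_le hσ haa hη0.le hi)).trans hsq
    have hterm : ∀ i, (pulls σ rule x i t : ℝ) * ((tiedMeans a a' l η i - μ i) ^ 2 / σ i ^ 2) ≤
        pulls σ rule x i t * (lam ^ 2 + κ / 2) + (ε * t + T) * H := by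
      intro i
      by_cases hi : i = a ∨ i = a'
      · have h1 := mul_le_mul_of_nonneg_left (hpair i hi)
          (Nat.cast_nonneg (α := ℝ) (pulls σ rule x i t))
        have h2 : 0 ≤ (ε * t + T) * H := by positivity
        linarith
      · push Not at hi
        have h1 := hpulls i hi.1 hi.2
        rw [tiedMeans_of_ne hi.1 hi.2]
        have h2 : 0 ≤ pulls σ rule x i t * (lam ^ 2 + κ / 2) := by positivity
        have h3 := mul_le_mul h1 (hH i) (by positivity) (by positivity)
        linarith
    calc ∑ i, (pulls σ rule x i t : ℝ) * ((tiedMeans a a' l η i - μ i) ^ 2 / σ i ^ 2)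
        ≤ ∑ i, (pulls σ rule x i t * (lam ^ 2 + κ / 2) + (ε * t + T) * H) :=
          Finset.sum_le_sum fun i _ => hterm i
      _ = t * (lam ^ 2 + κ / 2) + k * ε * H * t + k * (T * H) := by
          rw [Finset.sum_add_distrib, ← Finset.sum_mul, ← Nat.cast_sum, sum_pulls]
          simp
          ring
      _ ≤ t * (lam ^ 2 + κ / 2) + κ / 2 * t + k * (T * H) := by gcongr
      _ ≤ V := by rw [hV]; linarith

end TiedBound

/-! ### Two arms -/

section TwoArms

variable {k : ℕ} {σ : Fin k → ℝ} {rule : Knowledge k → Fin k}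

/-- If there are only two arms, then their distances to the maximum of the other arm agree, and the
arm with the larger `ζ` is pulled. -/
lemma zeta_le_of_two (hk : 2 ≤ k) (hσ : ∀ i, 0 < σ i) (hrule : IsKGRule σ rule)
    {i c : Fin k} (hic : i ≠ c) (htwo : ∀ j, j = i ∨ j = c) {x : Fin k → ℕ → ℝ} {s : ℕ}
    (hpull : pulledArm σ rule x s = i) (hi : pulls σ rule x i s ≠ 0) :
    pulls σ rule x c s ≠ 0 ∧
      zeta (σ c) (pulls σ rule x c s) ≤ zeta (σ i) (pulls σ rule x i s) := by
  obtain ⟨hc, hle⟩ := pulledArm_spec x hσ hrule hpull hi c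
  refine ⟨hc, ?_⟩
  have hmax : ∀ {u v : Fin k}, u ≠ v → (∀ j, j = u ∨ j = v) →
      maxOther (mean σ rule x s) u = mean σ rule x s v := by
    intro u v _ h
    obtain ⟨j, hj, hj'⟩ := exists_maxOther_eq hk (mean σ rule x s) u
    rw [hj', (h j).resolve_left hj]
  have hgap : gap σ rule x s c = gap σ rule x s i := by
    rw [gap, gap, hmax hic htwo, hmax hic.symm fun j => (htwo j).symm, abs_sub_comm]
  by_contra! hlt
  have hzi := zeta_pos (hσ i) hi
  rw [hgap] at hle
  have h0 : 0 ≤ gap σ rule x s i := abs_nonneg _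
  have h1 : f (-(gap σ rule x s i / zeta (σ i) (pulls σ rule x i s))) ≤
      f (-(gap σ rule x s i / zeta (σ c) (pulls σ rule x c s))) :=
    f_mono (neg_le_neg (div_le_div_of_nonneg_left h0 hzi hlt.le))
  have h2 := mul_le_mul_of_nonneg_left h1 hzi.le
  have h3 := mul_lt_mul_of_pos_right hlt
    (f_pos (-(gap σ rule x s i / zeta (σ c) (pulls σ rule x c s))))
  linarith

/-- If there are only two arms, both receive a fixed fraction of the pulls. -/
lemma le_pulls_of_two (hk : 2 ≤ k) (hσ : ∀ i, 0 < σ i) (hrule : IsKGRule σ rule) {lo hi : ℝ}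
    (hlo : 0 < lo) (hb : ∀ i, lo ≤ σ i ∧ σ i ≤ hi) {i c : Fin k} (hic : i ≠ c)
    (htwo : ∀ j, j = i ∨ j = c) (x : Fin k → ℕ → ℝ) (t : ℕ) :
    (t : ℝ) ≤ (hi / lo + 1) * (pulls σ rule x c t + 1) := by
  have hhi : 0 < hi := (hσ i).trans_le (hb i).2
  have hsum : (pulls σ rule x i t : ℝ) + pulls σ rule x c t = t := by
    have h1 := sum_pulls σ rule x t
    have h2 : (Finset.univ : Finset (Fin k)) = {i, c} := by
      ext j; simpa using htwo j
    rw [h2, Finset.sum_pair hic] at h1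
    exact_mod_cast h1
  have hkey : (pulls σ rule x i t : ℝ) ≤ hi / lo * (pulls σ rule x c t + 1) + 1 := by
    have hnc : (0 : ℝ) ≤ hi / lo * (pulls σ rule x c t + 1) := by positivity
    rcases Nat.lt_or_ge 1 (pulls σ rule x i t) with h | h
    · obtain ⟨s, hst, hpull, hm⟩ := exists_pull σ rule x (i := i) (t := t)
        (m := pulls σ rule x i t - 1) (by omega)
      have hi0 : pulls σ rule x i s ≠ 0 := by omega
      obtain ⟨hc0, hz⟩ := zeta_le_of_two hk hσ hrule hic htwo hpull hi0
      have hn : (0 : ℝ) < pulls σ rule x i s := by exact_mod_cast Nat.pos_of_ne_zero hi0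
      have h1 : lo / (pulls σ rule x c t + 1) ≤ hi / pulls σ rule x i s := by
        have hcs : (pulls σ rule x c s : ℝ) ≤ pulls σ rule x c t := by
          exact_mod_cast pulls_mono σ rule x c hst.le
        calc lo / (pulls σ rule x c t + 1) ≤ σ c / (pulls σ rule x c s + 1) :=
              div_le_div₀ (hσ c).le (hb c).1 (by positivity) (by linarith)
          _ ≤ _ := le_zeta (hσ c) hc0
          _ ≤ _ := hz
          _ ≤ _ := zeta_le (hσ i) hi0
          _ ≤ _ := by gcongr; exact (hb i).2
      rw [div_le_div_iff₀ (by positivity) hn] at h1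
      have h2 : (pulls σ rule x i s : ℝ) ≤ hi / lo * (pulls σ rule x c t + 1) := by
        rw [div_mul_eq_mul_div, le_div_iff₀ hlo]
        linarith
      have h3 : (pulls σ rule x i s : ℝ) = pulls σ rule x i t - 1 := by
        rw [hm, Nat.cast_sub (by omega), Nat.cast_one]
      linarith
    · have : (pulls σ rule x i t : ℝ) ≤ 1 := by exact_mod_cast h
      linarith
  linarith

variable {μ : Fin k → ℝ} {Ω : Type*} [MeasurableSpace Ω] {P : Measure Ω} [IsProbabilityMeasure P]
  {X : Fin k → ℕ → Ω → ℝ}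

/-- For two arms, the probability of error is at least
`exp (- λ² t / 2 - O(√t))`, where a shift of `λ` standard deviations each makes the arms equal. -/
theorem exists_le_probError_of_two (hk : 2 ≤ k) (hσ : ∀ i, 0 < σ i) (hrule : IsKGRule σ rule)
    (hX : IsRewardModel P μ σ X) {recom : (Fin k → ℝ) → Fin k} (hrecom : IsRecommendation recom)
    {b j : Fin k} (hbj : b ≠ j) (htwo : ∀ i, i = b ∨ i = j) :
    ∃ (C : ℝ) (T : ℕ), 0 < C ∧ ∀ t : ℕ, T ≤ t → ∀ V,
      V = (|μ b - μ j| / (σ b + σ j) + C / Real.sqrt t) ^ 2 * t →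
      1 / 4 * Real.exp (-(V / 2 + 2 * Real.sqrt V)) ≤ probError P σ rule recom X b t := by
  have : NeZero k := ⟨by omega⟩
  obtain ⟨lo, hi, hlo, hhi, hb⟩ := exists_sigma_bounds hσ
  set lam := |μ b - μ j| / (σ b + σ j)
  have hlam0 : 0 ≤ lam := by have := hσ b; have := hσ j; positivity
  set l := (σ j * μ b + σ b * μ j) / (σ b + σ j)
  set r := hi / lo + 1 with hr
  have hr0 : 0 < r := by positivity
  have hlog : 0 ≤ hi ^ 2 * Real.log (4 * k) := by
    have : (2 : ℝ) ≤ k := by exact_mod_cast hk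
    have := Real.log_nonneg (show (1 : ℝ) ≤ 4 * k by linarith)
    positivity
  -- the gap `4 K / √t` of the shifted means exceeds the fluctuations of the sample means
  set K := 1 + 4 * r * (hi ^ 2 * Real.log (4 * k)) with hK
  have hK1 : 1 ≤ K := by rw [hK]; linarith [mul_nonneg (mul_nonneg zero_le_four hr0.le) hlog]
  obtain ⟨T, hT⟩ := exists_nat_gt (2 * r)
  refine ⟨2 * K / lo, T, by positivity, fun t ht V hV => ?_⟩
  have htr : 2 * r < t := hT.trans_le (by exact_mod_cast ht)
  have ht0 : (0 : ℝ) < t := by linarith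
  set w := Real.sqrt t with hw
  have hw0 : 0 < w := Real.sqrt_pos.2 ht0
  have hwt : w ^ 2 = t := Real.sq_sqrt ht0.le
  set η := K / w with hη
  have hη0 : 0 < η := by positivity
  set C := hi ^ 2 * Real.log (4 * k) / η with hC
  have hV0 : 0 < V := by rw [hV]; positivity
  refine le_probError hσ hrule.measurable hX recom b (fun i => tiedMeans b j l η i - μ i) hη0 hV0
    (C := C) (exp_neg_intercept_le hσ (fun i => (hb i).2) (mul_div_cancel₀ _ hη0.ne').ge) t
    fun x hx => ?_
  have hx' : Concentrated σ rule (tiedMeans b j l η) η C x t := by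
    simpa using hx
  have hpulls : ∀ c, (t : ℝ) ≤ 2 * r * pulls σ rule x c t := by
    intro c
    have h1 : (t : ℝ) ≤ r * (pulls σ rule x c t + 1) := by
      rcases htwo c with rfl | rfl
      · exact le_pulls_of_two hk hσ hrule hlo hb hbj.symm (fun i => (htwo i).symm) x t
      · exact le_pulls_of_two hk hσ hrule hlo hb hbj htwo x t
    linarith
  have hclose : ∀ i, |mean σ rule x t i - tiedMeans b j l η i| ≤ η := by
    intro i
    have hn : (0 : ℝ) < pulls σ rule x i t := by
      by_contra! h
      have := hpulls i
      nlinarith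
    have hi0 : pulls σ rule x i t ≠ 0 := by
      intro h0; rw [h0, Nat.cast_zero] at hn; exact lt_irrefl _ hn
    refine (hx'.abs_mean_sub_le hσ le_rfl hi0).trans ?_
    have h1 : C / pulls σ rule x i t ≤ η / 2 := by
      rw [div_le_iff₀ hn, hC, div_le_iff₀ hη0]
      have h2 : η * η * t = K ^ 2 := by
        rw [hη, ← hwt]; field_simp
      have h3 : K ^ 2 ≤ η * η * (2 * r * pulls σ rule x i t) := by
        rw [← h2]; exact mul_le_mul_of_nonneg_left (hpulls i) (by positivity)
      have h4 : 4 * r * (hi ^ 2 * Real.log (4 * k)) ≤ K ^ 2 := by nlinarith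
      have h5 : 4 * r * (hi ^ 2 * Real.log (4 * k)) ≤
          4 * r * (η / 2 * pulls σ rule x i t * η) := by linarith
      exact le_of_mul_le_mul_left h5 (by positivity)
    linarith
  constructor
  · intro hJ
    have h1 := hrecom.isMax (knowledge σ rule x t).1 j
    rw [show recom (knowledge σ rule x t).1 = b from hJ] at h1
    have h2 := abs_le.1 (hclose b)
    have h3 := abs_le.1 (hclose j)
    rw [tiedMeans_left] at h2
    rw [tiedMeans_right hbj] at h3
    have h4 : mean σ rule x t j ≤ mean σ rule x t b := h1
    linarith
  · have hterm : ∀ i, (tiedMeans b j l η i - μ i) ^ 2 / σ i ^ 2 ≤ (lam + 2 * K / lo / w) ^ 2 := by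
      intro i
      have hpair := abs_tiedMeans_sub_le (μ := μ) hσ hbj hη0.le (htwo i)
      refine (sq_div_sq_le hlo hη0.le (hb i).1 hpair).trans (le_of_eq ?_)
      rw [hη]
      congr 2
      field_simp
    calc ∑ i, (pulls σ rule x i t : ℝ) * ((tiedMeans b j l η i - μ i) ^ 2 / σ i ^ 2)
        ≤ ∑ i, (pulls σ rule x i t : ℝ) * (lam + 2 * K / lo / w) ^ 2 := by
          refine Finset.sum_le_sum fun i _ => ?_
          exact mul_le_mul_of_nonneg_left (hterm i) (Nat.cast_nonneg _)
      _ = V := by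
          rw [← Finset.sum_mul, ← Nat.cast_sum, sum_pulls, hV, mul_comm]

end TwoArms

/-! ### Asymptotics of the lower bound -/

section Asymptotics

variable {k : ℕ} {μ σ : Fin k → ℝ} {b : Fin k}

lemma maxOther_lt (hk : 2 ≤ k) (hb : ∀ i, i ≠ b → μ i < μ b) : maxOther μ b < μ b := by
  obtain ⟨j, hj, h⟩ := exists_maxOther_eq hk μ b
  rw [h]
  exact hb j hj

variable (μ σ b) in
/-- The limit of the ratio of the numbers of pulls of arm `i` and of the best arm. -/
noncomputable def rho (i : Fin k) : ℝ := (μ b - maxOther μ b) / σ b * (σ i / (μ b - μ i))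

variable (μ σ b) in
/-- The limit of `sumLow` and `sumUp`. -/
noncomputable def sumRho : ℝ := 1 + ∑ i ∈ Finset.univ.erase b, rho μ σ b i

lemma rho_pos (hk : 2 ≤ k) (hσ : ∀ i, 0 < σ i) (hb : ∀ i, i ≠ b → μ i < μ b) {i : Fin k}
    (hi : i ≠ b) : 0 < rho μ σ b i := by
  have h1 := sub_pos.2 (maxOther_lt hk hb)
  have h2 := sub_pos.2 (hb i hi)
  have := hσ i
  have := hσ b
  rw [rho]
  positivity

lemma one_le_sumRho (hk : 2 ≤ k) (hσ : ∀ i, 0 < σ i) (hb : ∀ i, i ≠ b → μ i < μ b) :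
    1 ≤ sumRho μ σ b := by
  have : 0 ≤ ∑ i ∈ Finset.univ.erase b, rho μ σ b i :=
    Finset.sum_nonneg fun i hi => (rho_pos hk hσ hb (Finset.ne_of_mem_erase hi)).le
  rw [sumRho]
  linarith

lemma tendsto_mul_rpow_neg {c p : ℝ} (hc : 0 < c) (hp : 0 < p) :
    Tendsto (fun t : ℝ => (c * t) ^ (-p)) atTop (𝓝 0) :=
  (tendsto_rpow_neg_atTop hp).comp (tendsto_id.const_mul_atTop hc)

lemma sq_div_sq_rpow_half {G s : ℝ} (hG : 0 < G) (hs : 0 < s) :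
    (G ^ 2 / s ^ 2) ^ (1 / 2 : ℝ) = G / s := by
  rw [← div_pow, ← Real.sqrt_eq_rpow, Real.sqrt_sq (by positivity)]

lemma sq_div_sq_rpow_neg_half {G s : ℝ} (hG : 0 < G) (hs : 0 < s) :
    (G ^ 2 / s ^ 2) ^ (-(1 / 2) : ℝ) = s / G := by
  rw [Real.rpow_neg (by positivity), sq_div_sq_rpow_half hG hs, inv_div]

lemma tendsto_mul_rpow_of_errors {G s p c : ℝ} (hs : 0 < s) (hG : 0 < G) {e₁ e₂ e₃ F : ℝ → ℝ}
    (h₁ : Tendsto e₁ atTop (𝓝 0)) (h₂ : Tendsto e₂ atTop (𝓝 0)) (h₃ : Tendsto e₃ atTop (𝓝 0))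
    (hF : Tendsto F atTop (𝓝 c)) :
    Tendsto (fun t => F t * ((G + e₁ t) ^ 2 / s ^ 2 + e₂ t + e₃ t) ^ p) atTop
      (𝓝 (c * (G ^ 2 / s ^ 2) ^ p)) := by
  have h0 : Tendsto (fun t => (G + e₁ t) ^ 2 / s ^ 2 + e₂ t + e₃ t) atTop
      (𝓝 ((G + 0) ^ 2 / s ^ 2 + 0 + 0)) :=
    ((((h₁.const_add G).pow 2).div_const _).add h₂).add h₃
  rw [add_zero, add_zero, add_zero] at h0
  exact hF.mul (h0.rpow_const (Or.inl (by positivity)))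

lemma tendsto_const_div_sqrt (c : ℝ) {a : ℝ} (ha : 0 < a) :
    Tendsto (fun t : ℝ => c / Real.sqrt (a * t)) atTop (𝓝 0) :=
  (Real.tendsto_sqrt_atTop.comp (tendsto_id.const_mul_atTop ha)).const_div_atTop c

lemma tendsto_const_div_mul (c : ℝ) {a : ℝ} (ha : 0 < a) :
    Tendsto (fun t : ℝ => c / (a * t)) atTop (𝓝 0) :=
  (tendsto_id.const_mul_atTop ha).const_div_atTop c

lemma tendsto_three_quarters_rpow :
    Tendsto (fun t : ℝ => (3 / 4 * t) ^ (-(1 / 4) : ℝ)) atTop (𝓝 0) :=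
  tendsto_mul_rpow_neg (by norm_num) (by norm_num)

lemma tendsto_rpow_quarter : Tendsto (fun t : ℝ => t ^ (-(1 / 4) : ℝ)) atTop (𝓝 0) :=
  tendsto_rpow_neg_atTop (by norm_num)

lemma tendsto_three_div_four_rpow (hk : 0 < k) :
    Tendsto (fun t : ℝ => (3 * t / (4 * k)) ^ (-(3 / 4) : ℝ)) atTop (𝓝 0) := by
  have hk' : (0 : ℝ) < k := by exact_mod_cast hk
  refine (tendsto_mul_rpow_neg (c := 3 / (4 * k)) (p := 3 / 4) (by positivity)
    (by norm_num)).congr fun t => ?_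
  rw [div_mul_eq_mul_div]

lemma tendsto_div_rpow (hk : 0 < k) :
    Tendsto (fun t : ℝ => (t / k) ^ (-(3 / 4) : ℝ)) atTop (𝓝 0) := by
  have hk' : (0 : ℝ) < k := by exact_mod_cast hk
  refine (tendsto_mul_rpow_neg (c := (k : ℝ)⁻¹) (p := 3 / 4) (by positivity)
    (by norm_num)).congr fun t => ?_
  rw [div_eq_inv_mul t]

lemma tendsto_rhoLow (hk : 2 ≤ k) (hσ : ∀ i, 0 < σ i) (hb : ∀ i, i ≠ b → μ i < μ b) {i : Fin k}
    (hi : i ≠ b) : Tendsto (rhoLow μ σ b i) atTop (𝓝 (rho μ σ b i)) := by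
  have hG := sub_pos.2 (hb i hi)
  have hσb := hσ b
  have hk0 : 0 < k := by omega
  have h1 : Tendsto (rhoLow1 μ σ b i) atTop (𝓝 (rho μ σ b i)) := by
    have hF : Tendsto (fun t : ℝ => (μ b - maxOther μ b - (3 / 4 * t) ^ (-(1 / 4) : ℝ)) /
        ((1 + (3 * t / (4 * k)) ^ (-(3 / 4) : ℝ)) ^ 2 * σ b)) atTop
        (𝓝 ((μ b - maxOther μ b - 0) / ((1 + 0) ^ 2 * σ b))) :=
      (tendsto_three_quarters_rpow.const_sub _).div
        ((((tendsto_three_div_four_rpow hk0).const_add 1).pow 2).mul_const _) (by positivity)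
    have h := tendsto_mul_rpow_of_errors (p := -(1 / 2)) (hσ i) hG tendsto_three_quarters_rpow
      (tendsto_const_div_sqrt (16 * k) three_pos)
      (tendsto_const_div_mul (8 * k * logTerm μ σ) three_pos) hF
    rw [sq_div_sq_rpow_neg_half hG (hσ i), sub_zero, add_zero, one_pow, one_mul] at h
    exact h
  have h2 : Tendsto (rhoLow2 μ σ b i) atTop (𝓝 (rho μ σ b i)) := by
    have hF : Tendsto (fun t : ℝ => (μ b - maxOther μ b - t ^ (-(1 / 4) : ℝ)) /
        ((1 + (t / k) ^ (-(3 / 4) : ℝ)) * σ b)) atTop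
        (𝓝 ((μ b - maxOther μ b - 0) / ((1 + 0) * σ b))) :=
      (tendsto_rpow_quarter.const_sub _).div
        (((tendsto_div_rpow hk0).const_add 1).mul_const _) (by simpa using hσb.ne')
    have h := tendsto_mul_rpow_of_errors (p := -(1 / 2)) (hσ i) hG tendsto_rpow_quarter
      (tendsto_const_div_sqrt (8 * k) one_pos)
      (tendsto_const_div_mul (2 * k * logTerm μ σ) one_pos) hF
    simp only [one_mul] at h
    rw [sq_div_sq_rpow_neg_half hG (hσ i), sub_zero, add_zero, one_mul] at h
    exact h
  simpa using! h1.min h2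

lemma tendsto_rhoUp (hk : 2 ≤ k) (hσ : ∀ i, 0 < σ i) (hb : ∀ i, i ≠ b → μ i < μ b) {i : Fin k}
    (hi : i ≠ b) : Tendsto (rhoUp μ σ b i) atTop (𝓝 (rho μ σ b i)) := by
  have hG := sub_pos.2 (hb i hi)
  have hD := sub_pos.2 (maxOther_lt hk hb)
  have hk0 : 0 < k := by omega
  have heq : σ i / (μ b - μ i) * ((μ b - maxOther μ b) / σ b) = rho μ σ b i := mul_comm _ _
  have h1 : Tendsto (rhoUp1 μ σ b i) atTop (𝓝 (rho μ σ b i)) := by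
    have hF : Tendsto (fun t : ℝ => (1 + (t / k) ^ (-(3 / 4) : ℝ)) * σ i /
        (μ b - μ i - t ^ (-(1 / 4) : ℝ))) atTop (𝓝 ((1 + 0) * σ i / (μ b - μ i - 0))) :=
      (((tendsto_div_rpow hk0).const_add 1).mul_const _).div
        (tendsto_rpow_quarter.const_sub _) (by simpa using hG.ne')
    have h := tendsto_mul_rpow_of_errors (p := 1 / 2) (hσ b) hD tendsto_rpow_quarter
      (tendsto_const_div_sqrt (8 * k) one_pos)
      (tendsto_const_div_mul (2 * k * logTerm μ σ) one_pos) hF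
    simp only [one_mul] at h
    rw [sq_div_sq_rpow_half hD (hσ b), sub_zero, add_zero, one_mul, heq] at h
    exact h
  have h2 : Tendsto (rhoUp2 μ σ b i) atTop (𝓝 (rho μ σ b i)) := by
    have hF : Tendsto (fun t : ℝ => (1 + (3 * t / (4 * k)) ^ (-(3 / 4) : ℝ)) ^ 2 * σ i /
        (μ b - μ i - (3 / 4 * t) ^ (-(1 / 4) : ℝ))) atTop
        (𝓝 ((1 + 0) ^ 2 * σ i / (μ b - μ i - 0))) :=
      ((((tendsto_three_div_four_rpow hk0).const_add 1).pow 2).mul_const _).div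
        (tendsto_three_quarters_rpow.const_sub _) (by simpa using hG.ne')
    have h := tendsto_mul_rpow_of_errors (p := 1 / 2) (hσ b) hD tendsto_three_quarters_rpow
      (tendsto_const_div_sqrt (16 * k) three_pos)
      (tendsto_const_div_mul (8 * k * logTerm μ σ) three_pos) hF
    rw [sq_div_sq_rpow_half hD (hσ b), sub_zero, add_zero, one_pow, one_mul, heq] at h
    exact h
  simpa using! h1.max h2

lemma tendsto_sumLow (hk : 2 ≤ k) (hσ : ∀ i, 0 < σ i) (hb : ∀ i, i ≠ b → μ i < μ b) :
    Tendsto (sumLow μ σ b) atTop (𝓝 (sumRho μ σ b)) :=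
  (tendsto_finsetSum _ fun _ hi => tendsto_rhoLow hk hσ hb (Finset.ne_of_mem_erase hi)).const_add 1

lemma tendsto_sumUp (hk : 2 ≤ k) (hσ : ∀ i, 0 < σ i) (hb : ∀ i, i ≠ b → μ i < μ b) :
    Tendsto (sumUp μ σ b) atTop (𝓝 (sumRho μ σ b)) :=
  (tendsto_finsetSum _ fun _ hi => tendsto_rhoUp hk hσ hb (Finset.ne_of_mem_erase hi)).const_add 1

lemma deltaMin_pos_and_le (hk : 2 ≤ k) (hb : ∀ i, i ≠ b → μ i < μ b) :
    0 < deltaMin μ ∧ ∀ i j, μ i < μ j → deltaMin μ ≤ μ j - μ i := by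
  set S := {d : ℝ | 0 < d ∧ ∃ i₁ i₂ : Fin k, i₁ ≠ i₂ ∧ d = |μ i₁ - μ i₂|} with hS
  have hfin : S.Finite := by
    refine (Set.finite_range fun p : Fin k × Fin k => |μ p.1 - μ p.2|).subset ?_
    rintro d ⟨_, i, j, _, rfl⟩
    exact ⟨(i, j), rfl⟩
  have hmem : ∀ i j, μ i < μ j → μ j - μ i ∈ S := by
    intro i j hij
    have h := sub_pos.2 hij
    exact ⟨h, j, i, fun h => by rw [h] at hij; exact lt_irrefl _ hij, (abs_of_pos h).symm⟩
  obtain ⟨j, hj, -⟩ := exists_maxOther_eq hk μ b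
  have hne : S.Nonempty := ⟨_, hmem j b (hb j hj)⟩
  exact ⟨(hne.csInf_mem hfin).1, fun i j hij => csInf_le hfin.bddBelow (hmem i j hij)⟩

variable (μ σ b) in
/-- The exponent of `tailProduct`. -/
noncomputable def tailExponent (j : Fin k) (t : ℝ) : ℝ :=
  deltaMin μ ^ 2 * rhoUp μ σ b j t * t / (8 * σ j ^ 2 * sumLow μ σ b t) +
    (μ b - μ j - deltaMin μ / 2) ^ 2 * t / (2 * σ b ^ 2 * sumLow μ σ b t)

lemma tendsto_tailExponent_div (hk : 2 ≤ k) (hσ : ∀ i, 0 < σ i) (hb : ∀ i, i ≠ b → μ i < μ b)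
    {j : Fin k} (hj : j ≠ b) :
    Tendsto (fun t => tailExponent μ σ b j t / t) atTop
      (𝓝 (deltaMin μ ^ 2 * rho μ σ b j / (8 * σ j ^ 2 * sumRho μ σ b) +
        (μ b - μ j - deltaMin μ / 2) ^ 2 / (2 * σ b ^ 2 * sumRho μ σ b))) := by
  have hS := zero_lt_one.trans_le (one_le_sumRho hk hσ hb)
  have h1 := hσ j
  have h2 := hσ b
  have hlim := ((((tendsto_rhoUp hk hσ hb hj).const_mul (deltaMin μ ^ 2))).div
    ((tendsto_sumLow hk hσ hb).const_mul (8 * σ j ^ 2)) (by positivity)).add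
    ((tendsto_const_nhds (x := (μ b - μ j - deltaMin μ / 2) ^ 2)).div
    ((tendsto_sumLow hk hσ hb).const_mul (2 * σ b ^ 2)) (by positivity))
  refine hlim.congr' ?_
  filter_upwards [eventually_gt_atTop 0] with t ht
  simp only [Pi.div_apply, tailExponent]
  have h3 : ∀ a c : ℝ, a * t / c / t = a / c := fun a c => by
    rw [mul_div_right_comm, mul_div_cancel_right₀ _ ht.ne']
  rw [add_div, h3, h3]

lemma exists_tailProduct_le (hk : 2 ≤ k) (hσ : ∀ i, 0 < σ i) (hb : ∀ i, i ≠ b → μ i < μ b)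
    {j : Fin k} (hj : j ≠ b) :
    ∃ C : ℝ, 0 < C ∧ ∀ᶠ t in atTop,
      tailProduct μ σ b j t ≤ C * Real.exp (-tailExponent μ σ b j t) := by
  have hS := zero_lt_one.trans_le (one_le_sumRho hk hσ hb)
  have hρ := rho_pos hk hσ hb hj
  have hσj := hσ j
  have hσb := hσ b
  obtain ⟨hδ, hδ'⟩ := deltaMin_pos_and_le hk hb
  have hg : 0 < μ b - μ j - deltaMin μ / 2 := by linarith [hδ' j b (hb j hj)]
  set g := μ b - μ j - deltaMin μ / 2 with hgdef
  have hlow := tendsto_rhoLow hk hσ hb hj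
  have hup := tendsto_rhoUp hk hσ hb hj
  have hSl := tendsto_sumLow hk hσ hb
  have hSu := tendsto_sumUp hk hσ hb
  have hA := ((hlow.div hSu hS.ne').sqrt).const_mul (deltaMin μ / (2 * σ j))
  have hB := (hSl.const_mul (σ b)).div (hSu.sqrt.const_mul g)
    (mul_pos hg (Real.sqrt_pos.2 hS)).ne'
  set A := deltaMin μ / (2 * σ j) * Real.sqrt (rho μ σ b j / sumRho μ σ b) with hAdef
  set B := σ b * sumRho μ σ b / (g * Real.sqrt (sumRho μ σ b)) with hBdef
  have hA0 : 0 ≤ A := by positivity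
  have hB0 : 0 ≤ B := by positivity
  refine ⟨(A + 1) * (B + 1), by positivity, ?_⟩
  filter_upwards [eventually_gt_atTop 0, hA.eventually_le_const (lt_add_one A),
    hB.eventually_le_const (lt_add_one B), hup.eventually_const_le hρ,
    hSl.eventually_const_lt hS, hSu.eventually_const_lt hS] with t ht h1 h2 h3 h4 h5
  simp only [Pi.div_apply] at h1 h2
  have hsq := Real.sqrt_pos.2 h5
  have hp1 : deltaMin μ / (2 * σ j) * Real.sqrt (rhoLow μ σ b j t / sumUp μ σ b t) /
      (1 + deltaMin μ ^ 2 * rhoUp μ σ b j t * t / (4 * σ j ^ 2 * sumLow μ σ b t)) ≤ A + 1 := by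
    refine (div_le_self (by positivity) ?_).trans h1
    have : 0 ≤ deltaMin μ ^ 2 * rhoUp μ σ b j t * t / (4 * σ j ^ 2 * sumLow μ σ b t) := by
      positivity
    linarith
  have hp2 : g * t / (σ b * Real.sqrt (sumUp μ σ b t)) /
      (1 + g ^ 2 * t / (σ b ^ 2 * sumLow μ σ b t)) ≤ B + 1 := by
    refine le_trans ?_ h2
    calc _ ≤ g * t / (σ b * Real.sqrt (sumUp μ σ b t)) /
          (g ^ 2 * t / (σ b ^ 2 * sumLow μ σ b t)) :=
          div_le_div_of_nonneg_left (by positivity) (by positivity) (by linarith)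
      _ = _ := by field_simp
  have hp2' : 0 ≤ g * t / (σ b * Real.sqrt (sumUp μ σ b t)) /
      (1 + g ^ 2 * t / (σ b ^ 2 * sumLow μ σ b t)) := by positivity
  rw [tailProduct, tailExponent, ← hgdef, mul_assoc _ (Real.exp _), ← Real.exp_add, ← neg_add]
  refine mul_le_mul_of_nonneg_right ?_ (Real.exp_nonneg _)
  exact mul_le_mul hp1 hp2 hp2' (by positivity)

lemma eventually_abs_one_sub_q_le (hσ : ∀ i, 0 < σ i) :
    ∀ᶠ t in atTop, |1 - q σ (3 / 4 * t)| ≤ 1 := by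
  have hmax : 0 ≤ sigmaMax σ := Real.iSup_nonneg fun i => (hσ i).le
  set A := 4 * sigmaMax σ * (k : ℝ) ^ (-(1 / 8) : ℝ) with hA
  have hA0 : 0 ≤ A := by positivity
  have h := (tendsto_mul_rpow_neg (c := 3 / 4) (p := 1 / 8) (by norm_num) (by norm_num)).const_mul A
  rw [mul_zero] at h
  filter_upwards [h.eventually_le_const two_pos, eventually_gt_atTop 0] with t ht ht0
  have h1 : 0 ≤ q σ (3 / 4 * t) := by
    unfold q; positivity
  have h2 : q σ (3 / 4 * t) ≤ 2 := by
    refine le_trans ?_ ht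
    rw [q, ← hA]
    refine mul_le_of_le_one_right (by positivity) (Real.exp_le_one_iff.2 ?_)
    rw [neg_div, neg_nonpos]
    positivity
  rw [abs_le]
  constructor <;> linarith

theorem exists_peLowerBound_le (hk : 2 ≤ k) (hσ : ∀ i, 0 < σ i) (hb : ∀ i, i ≠ b → μ i < μ b)
    {j : Fin k} (hj : j ≠ b) :
    ∃ C : ℝ, 0 < C ∧ ∀ᶠ t in atTop,
      peLowerBound μ σ b t ≤ C * Real.exp (-tailExponent μ σ b j t) := by
  obtain ⟨C, hC, h⟩ := exists_tailProduct_le hk hσ hb hj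
  refine ⟨C, hC, ?_⟩
  filter_upwards [h, eventually_abs_one_sub_q_le hσ] with t ht hq
  have h1 : (1 - q σ (3 / 4 * t)) ^ (2 * k) / (2 * Real.pi) ≤ 1 := by
    rw [div_le_one (by positivity)]
    have h2 : (1 - q σ (3 / 4 * t)) ^ (2 * k) ≤ 1 := by
      rw [pow_mul]
      refine pow_le_one₀ (sq_nonneg _) ?_
      rw [← sq_abs]
      exact pow_le_one₀ (abs_nonneg _) hq
    linarith [Real.two_le_pi]
  have h0 : 0 ≤ (1 - q σ (3 / 4 * t)) ^ (2 * k) / (2 * Real.pi) :=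
    div_nonneg (by rw [pow_mul]; positivity) (by positivity)
  have h2 : ⨅ j : {j : Fin k // j ≠ b}, tailProduct μ σ b j t ≤ tailProduct μ σ b j t :=
    ciInf_le (f := fun j : {j : Fin k // j ≠ b} => tailProduct μ σ b j t)
      (Set.finite_range _).bddBelow ⟨j, hj⟩
  rw [peLowerBound]
  calc _ ≤ (1 - q σ (3 / 4 * t)) ^ (2 * k) / (2 * Real.pi) *
        (C * Real.exp (-tailExponent μ σ b j t)) := mul_le_mul_of_nonneg_left (h2.trans ht) h0
    _ ≤ _ := mul_le_of_le_one_left (by positivity) h1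

end Asymptotics

/-! ### Comparison of the exponential rates -/

section Rates

/-- Disjoint intervals with centres `m i` and radii `r i` inside `[u, v]` have total length at most
`v - u`. -/
lemma sum_two_mul_radius_le {ι : Type*} (m r : ι → ℝ) (S : Finset ι)
    (hsep : ∀ i ∈ S, ∀ j ∈ S, i ≠ j → r i + r j ≤ |m i - m j|) {u v : ℝ} (huv : u ≤ v)
    (hr : ∀ i ∈ S, 0 ≤ r i) (hu : ∀ i ∈ S, u ≤ m i - r i) (hv : ∀ i ∈ S, m i + r i ≤ v) :
    ∑ i ∈ S, 2 * r i ≤ v - u := by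
  classical
  induction S using Finset.induction_on_max_value m generalizing v with
  | empty => simpa using huv
  | insert a S ha hmax ih =>
    rw [Finset.sum_insert ha]
    have h1 : ∑ i ∈ S, 2 * r i ≤ (m a - r a) - u := by
      refine ih (fun i hi j hj => hsep i (Finset.mem_insert_of_mem hi) j
        (Finset.mem_insert_of_mem hj)) (hu a (Finset.mem_insert_self a S))
        (fun i hi => hr i (Finset.mem_insert_of_mem hi))
        (fun i hi => hu i (Finset.mem_insert_of_mem hi)) fun i hi => ?_
      have h2 := hsep i (Finset.mem_insert_of_mem hi) a (Finset.mem_insert_self a S)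
        (fun h => ha (h ▸ hi))
      rw [abs_of_nonpos (sub_nonpos.2 (hmax i hi))] at h2
      linarith
    have h3 := hv a (Finset.mem_insert_self a S)
    linarith

variable {k : ℕ} {μ σ : Fin k → ℝ} {b : Fin k}

lemma exists_min_pair (hk : 2 ≤ k) (hσ : ∀ i, 0 < σ i) (b : Fin k) :
    ∃ a a' : Fin k, a ≠ a' ∧ a' ≠ b ∧ ∀ i i', i ≠ i' →
      |μ a - μ a'| / (σ a + σ a') * (σ i + σ i') ≤ |μ i - μ i'| := by
  have : Nontrivial (Fin k) := Fin.nontrivial_iff_two_le.2 hk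
  have hne : ((Finset.univ : Finset (Fin k)).offDiag).Nonempty := by
    obtain ⟨i, j, hij⟩ := exists_pair_ne (Fin k)
    exact ⟨(i, j), by simpa using hij⟩
  obtain ⟨p, hp, hmin⟩ := Finset.exists_min_image _
    (fun p : Fin k × Fin k => |μ p.1 - μ p.2| / (σ p.1 + σ p.2)) hne
  have hp' : p.1 ≠ p.2 := by simpa using hp
  have hmin' : ∀ i i', i ≠ i' →
      |μ p.1 - μ p.2| / (σ p.1 + σ p.2) * (σ i + σ i') ≤ |μ i - μ i'| := by
    intro i i' h
    have h1 := hmin (i, i') (by simpa using h)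
    rwa [le_div_iff₀ (add_pos (hσ i) (hσ i'))] at h1
  by_cases h2 : p.2 = b
  · refine ⟨p.2, p.1, hp'.symm, fun h => hp' (h.trans h2.symm), ?_⟩
    rwa [abs_sub_comm, add_comm (σ p.2)]
  · exact ⟨p.1, p.2, hp', h2, hmin'⟩

/-- With at least three arms, the rate of `tailProduct` for the arm with the lowest mean is larger
than the rate `λ² / 2` for the pair of arms that is easiest to confuse. -/
lemma exists_rate_lt (hk : 3 ≤ k) (hσ : ∀ i, 0 < σ i) (hb : ∀ i, i ≠ b → μ i < μ b) {lam : ℝ}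
    (hlam : 0 ≤ lam) (hpair : ∀ i i', i ≠ i' → lam * (σ i + σ i') ≤ |μ i - μ i'|) :
    ∃ j, j ≠ b ∧ lam ^ 2 / 2 < deltaMin μ ^ 2 * rho μ σ b j / (8 * σ j ^ 2 * sumRho μ σ b) +
        (μ b - μ j - deltaMin μ / 2) ^ 2 / (2 * σ b ^ 2 * sumRho μ σ b) := by
  have hk2 : 2 ≤ k := by omega
  have hS := zero_lt_one.trans_le (one_le_sumRho hk2 hσ hb)
  obtain ⟨hδ, hδ'⟩ := deltaMin_pos_and_le hk2 hb
  obtain ⟨p, hpb, hp⟩ := exists_maxOther_eq hk2 μ b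
  have hσb := hσ b
  suffices h : ∃ j, j ≠ b ∧
      lam ^ 2 * (σ b ^ 2 * sumRho μ σ b) < (μ b - μ j - deltaMin μ / 2) ^ 2 by
    obtain ⟨j, hj, hlt⟩ := h
    refine ⟨j, hj, ?_⟩
    have hρ := rho_pos hk2 hσ hb hj
    have := hσ j
    have h1 : 0 ≤ deltaMin μ ^ 2 * rho μ σ b j / (8 * σ j ^ 2 * sumRho μ σ b) := by positivity
    have h2 : lam ^ 2 / 2 <
        (μ b - μ j - deltaMin μ / 2) ^ 2 / (2 * σ b ^ 2 * sumRho μ σ b) := by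
      rw [lt_div_iff₀ (by positivity)]
      linarith
    linarith
  rcases hlam.eq_or_lt with h0 | hpos
  · refine ⟨p, hpb, ?_⟩
    have := hδ' p b (hb p hpb)
    rw [← h0]
    have : 0 < μ b - μ p - deltaMin μ / 2 := by linarith
    rw [zero_pow two_ne_zero, zero_mul]
    positivity
  have hne : (Finset.univ.erase b).Nonempty := ⟨p, by simpa using hpb⟩
  obtain ⟨j, hj, hjmin⟩ := Finset.exists_min_image _ μ hne
  have hjb : j ≠ b := Finset.ne_of_mem_erase hj
  have hμp : ∀ i, i ≠ b → μ i ≤ μ p := fun i hi => hp ▸ le_maxOther μ hi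
  have hμj : ∀ i, i ≠ b → μ j ≤ μ i := fun i hi => hjmin i (by simpa using hi)
  -- `λ > 0` means that all means are distinct
  have hjp : μ j < μ p := by
    obtain ⟨i, hi⟩ : ∃ i : Fin k, i ∉ ({b, p} : Finset (Fin k)) := by
      by_contra! h
      have h1 : (Finset.univ : Finset (Fin k)).card ≤ 2 :=
        (Finset.card_le_card fun i _ => h i).trans Finset.card_le_two
      simp at h1
      omega
    simp only [Finset.mem_insert, Finset.mem_singleton, not_or] at hi
    have h1 := hpair i p hi.2
    have h2 : 0 < |μ i - μ p| := (mul_pos hpos (add_pos (hσ i) (hσ p))).trans_le h1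
    have h3 : μ i ≠ μ p := fun h => by simp [h] at h2
    exact (hμj i hi.1).trans_lt (lt_of_le_of_ne (hμp i hi.1) h3)
  have hne' : j ≠ p := fun h => by rw [h] at hjp; exact lt_irrefl _ hjp
  refine ⟨j, hjb, ?_⟩
  set D := μ b - μ p with hD
  set G := μ b - μ j with hG
  set u := lam * σ b with hu
  have hu0 : 0 < u := mul_pos hpos hσb
  have hD0 : 0 < D := sub_pos.2 (hb p hpb)
  have hGD : D < G := by linarith
  have huD : u ≤ D := by
    have h1 := hpair b p hpb.symm
    rw [abs_of_pos hD0] at h1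
    have := mul_pos hpos (hσ p)
    linarith
  have hsum : ∑ i ∈ Finset.univ.erase b, lam * σ i ≤ G - D := by
    have hjp' := hpair j p hne'
    rw [abs_of_neg (sub_neg.2 hjp)] at hjp'
    have hj0 := mul_pos hpos (hσ j)
    have hp0 := mul_pos hpos (hσ p)
    have h1 := sum_two_mul_radius_le μ (fun i => lam * σ i) (Finset.univ.erase b)
      (fun i _ i' _ h => by rw [← mul_add]; exact hpair i i' h)
      (u := μ j - lam * σ j) (v := μ p + lam * σ p) (by linarith)
      (fun i _ => (mul_pos hpos (hσ i)).le)
      (fun i hi => by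
        by_cases h : i = j
        · rw [h]
        · have h2 := hpair i j h
          rw [abs_of_nonneg (sub_nonneg.2 (hμj i (Finset.ne_of_mem_erase hi)))] at h2
          linarith)
      (fun i hi => by
        by_cases h : i = p
        · rw [h]
        · have h2 := hpair i p h
          rw [abs_of_nonpos (sub_nonpos.2 (hμp i (Finset.ne_of_mem_erase hi)))] at h2
          linarith)
    rw [← Finset.mul_sum] at h1
    linarith
  have hmain : lam ^ 2 * (σ b ^ 2 * sumRho μ σ b) ≤ u ^ 2 + u * (G - D) := by
    have h1 : lam ^ 2 * (σ b ^ 2 * sumRho μ σ b) =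
        u ^ 2 + ∑ i ∈ Finset.univ.erase b, u ^ 2 * rho μ σ b i := by
      rw [sumRho, hu, ← Finset.mul_sum]; ring
    rw [h1]
    have h2 : ∑ i ∈ Finset.univ.erase b, u ^ 2 * rho μ σ b i ≤
        ∑ i ∈ Finset.univ.erase b, u * (lam * σ i) := by
      refine Finset.sum_le_sum fun i hi => ?_
      have hib := Finset.ne_of_mem_erase hi
      have hGi : 0 < μ b - μ i := sub_pos.2 (hb i hib)
      have hDi : D / (μ b - μ i) ≤ 1 := by
        rw [div_le_one hGi]; linarith [hμp i hib]
      have h3 : u ^ 2 * rho μ σ b i = u * (lam * σ i) * (D / (μ b - μ i)) := by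
        rw [rho, hp, ← hD, hu]; field_simp
      rw [h3]
      exact mul_le_of_le_one_right (by have := hσ i; positivity) hDi
    rw [← Finset.mul_sum _ (fun i => lam * σ i)] at h2
    have h3 := mul_le_mul_of_nonneg_left hsum hu0.le
    linarith
  have hδG : deltaMin μ ≤ G - D := by linarith [hδ' j p hjp]
  have hg : (G + D) / 2 ≤ G - deltaMin μ / 2 := by linarith
  have hg2 := pow_le_pow_left₀ (by linarith) hg 2
  nlinarith [mul_le_mul huD huD hu0.le hD0.le, mul_le_mul_of_nonneg_right huD (sub_pos.2 hGD).le,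
    sq_pos_of_pos (sub_pos.2 hGD)]

lemma deltaMin_eq_of_two {j : Fin k} (hjb : μ j < μ b) (htwo : ∀ i, i = b ∨ i = j) :
    deltaMin μ = μ b - μ j := by
  have h := sub_pos.2 hjb
  have hne : b ≠ j := fun h => by rw [h] at hjb; exact lt_irrefl _ hjb
  have hS : {d : ℝ | 0 < d ∧ ∃ i₁ i₂ : Fin k, i₁ ≠ i₂ ∧ d = |μ i₁ - μ i₂|} = {μ b - μ j} := by
    ext d
    simp only [Set.mem_ofPred_eq, Set.mem_singleton_iff]
    constructor
    · rintro ⟨_, i, i', hii, rfl⟩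
      rcases htwo i with rfl | rfl <;> rcases htwo i' with rfl | rfl
      · exact absurd rfl hii
      · exact abs_of_pos h
      · rw [abs_sub_comm]; exact abs_of_pos h
      · exact absurd rfl hii
    · rintro rfl
      exact ⟨h, b, j, hne, (abs_of_pos h).symm⟩
  rw [deltaMin, hS, csInf_singleton]

/-- For two arms, the correction terms in `rhoLow` and `rhoUp` increase the exponent of
`tailProduct` by a multiple of `t^{3/4}`. -/
lemma exists_le_tailExponent_of_two (hk : 2 ≤ k) (hσ : ∀ i, 0 < σ i)
    (hb : ∀ i, i ≠ b → μ i < μ b) {j : Fin k} (hbj : b ≠ j) (htwo : ∀ i, i = b ∨ i = j) :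
    ∃ c : ℝ, 0 < c ∧ ∀ᶠ t : ℝ in atTop,
      (|μ b - μ j| / (σ b + σ j)) ^ 2 * t / 2 + c * (t * t ^ (-(1 / 4) : ℝ)) ≤
        tailExponent μ σ b j t := by
  have hσb := hσ b
  have hσj := hσ j
  have hμ := hb j hbj.symm
  have hδ := deltaMin_eq_of_two hμ htwo
  have hD0 := sub_pos.2 hμ
  rw [abs_of_pos hD0]
  have hmax : maxOther μ b = μ j := by
    obtain ⟨i, hi, h⟩ := exists_maxOther_eq hk μ b
    rw [h, (htwo i).resolve_left hi]
  set D := μ b - μ j with hD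
  have hL : 0 ≤ logTerm μ σ := le_max_right _ _
  have herase : Finset.univ.erase b = {j} := by
    ext i
    simp only [Finset.mem_erase, Finset.mem_univ, and_true, Finset.mem_singleton]
    exact ⟨fun h => (htwo i).resolve_left h, fun h => h ▸ hbj.symm⟩
  have hS := zero_lt_one.trans_le (one_le_sumRho hk hσ hb)
  refine ⟨D * σ j / (2 * (σ b + σ j) ^ 3), by positivity, ?_⟩
  filter_upwards [eventually_gt_atTop 0, tendsto_rpow_quarter.eventually_lt_const hD0,
    (tendsto_sumLow hk hσ hb).eventually_const_lt hS] with t ht he hSl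
  set e := t ^ (-(1 / 4) : ℝ) with hedef
  have he0 : 0 < e := Real.rpow_pos_of_pos ht _
  have hDe : 0 < D - e := sub_pos.2 he
  have hext : ∀ s : ℝ, 0 < s → (D + e) ^ 2 / s ^ 2 ≤
      (D + e) ^ 2 / s ^ 2 + 8 * k / Real.sqrt t + 2 * k * logTerm μ σ / t := by
    intro s _
    have h1 : 0 ≤ 8 * k / Real.sqrt t := by positivity
    have h2 : 0 ≤ 2 * k * logTerm μ σ / t := by positivity
    linarith
  have he34 : 1 ≤ 1 + (t / k) ^ (-(3 / 4) : ℝ) := by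
    have : 0 ≤ (t / k) ^ (-(3 / 4) : ℝ) := by positivity
    linarith
  have hlow : rhoLow μ σ b j t ≤ σ j / σ b * (1 - e / D) := by
    refine (min_le_right _ _).trans ?_
    rw [rhoLow2, hmax, ← hD, ← hedef]
    calc _ ≤ (D - e) / σ b * (σ j / (D + e)) := by
          refine mul_le_mul ?_ ?_ (by positivity) (by positivity)
          · exact div_le_div_of_nonneg_left hDe.le hσb (le_mul_of_one_le_left hσb.le he34)
          · rw [← sq_div_sq_rpow_neg_half (by positivity) hσj]
            exact Real.rpow_le_rpow_of_nonpos (by positivity) (hext _ hσj) (by norm_num)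
      _ = σ j / σ b * ((D - e) / (D + e)) := by ring
      _ ≤ _ := by
          gcongr
          rw [div_le_iff₀ (by positivity)]
          have h1 : (1 - e / D) * (D + e) = D - e ^ 2 / D := by field_simp; ring
          have h2 : e ^ 2 / D ≤ e := by
            rw [div_le_iff₀ hD0]; nlinarith
          linarith
  have hup : σ j / σ b ≤ rhoUp μ σ b j t := by
    refine le_trans ?_ (le_max_left _ _)
    rw [rhoUp1, hmax, ← hD, ← hedef]
    calc σ j / σ b = σ j / D * (D / σ b) := by field_simp
      _ ≤ (1 + (t / k) ^ (-(3 / 4) : ℝ)) * σ j / (D - e) * ((D + e) / σ b) := by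
          refine mul_le_mul ?_ ?_ (by positivity) (by positivity)
          · exact div_le_div₀ (by positivity) (le_mul_of_one_le_left hσj.le he34) hDe
              (by linarith)
          · gcongr; linarith
      _ ≤ _ := by
          refine mul_le_mul_of_nonneg_left ?_ (by positivity)
          rw [← sq_div_sq_rpow_half (by positivity) hσb]
          exact Real.rpow_le_rpow (by positivity) (hext _ hσb) (by norm_num)
  have hSle : sumLow μ σ b t ≤ (σ b + σ j - σ j * e / D) / σ b := by
    rw [sumLow, herase, Finset.sum_singleton]
    refine (add_le_add_right hlow 1).trans (le_of_eq ?_)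
    field_simp
    ring
  set w := σ j * e / D with hw
  have hw0 : 0 < w := by positivity
  have hwlt : w < σ b + σ j := by
    have : w ≤ σ j := by
      rw [hw, div_le_iff₀ hD0]; nlinarith
    linarith
  rw [tailExponent, hδ, ← hD]
  calc (D / (σ b + σ j)) ^ 2 * t / 2 + D * σ j / (2 * (σ b + σ j) ^ 3) * (t * e)
      = D ^ 2 * t / 8 * (4 / (σ b + σ j) ^ 2 * (1 + w / (σ b + σ j))) := by
        rw [hw]; field_simp; ring
    _ ≤ D ^ 2 * t / 8 * (1 / (σ j * σ b) * ((σ b + σ j) / (σ b + σ j - w))) := by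
        have h1 : 4 / (σ b + σ j) ^ 2 ≤ 1 / (σ j * σ b) := by
          rw [div_le_div_iff₀ (by positivity) (by positivity)]
          nlinarith [sq_nonneg (σ b - σ j)]
        have h2 : 1 + w / (σ b + σ j) ≤ (σ b + σ j) / (σ b + σ j - w) := by
          rw [le_div_iff₀ (sub_pos.2 hwlt)]
          have h3 : (1 + w / (σ b + σ j)) * (σ b + σ j - w) =
              σ b + σ j - w ^ 2 / (σ b + σ j) := by field_simp; ring
          have h4 : 0 ≤ w ^ 2 / (σ b + σ j) := by positivity
          linarith
        gcongr
    _ = D ^ 2 * t / 8 * ((σ j / σ b) / σ j ^ 2 + 1 / σ b ^ 2) /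
          ((σ b + σ j - w) / σ b) := by
        have := (sub_pos.2 hwlt).ne'
        field_simp
    _ ≤ D ^ 2 * t / 8 * (rhoUp μ σ b j t / σ j ^ 2 + 1 / σ b ^ 2) / sumLow μ σ b t := by
        have h0 : 0 < rhoUp μ σ b j t := (div_pos hσj hσb).trans_le hup
        gcongr
    _ = _ := by
        field_simp
        ring

end Rates

/-! ### The lower bounds for the probability of error and the simple regret -/

section Final

variable {k : ℕ} {μ σ : Fin k → ℝ} {b : Fin k} {rule : Knowledge k → Fin k}
  {recom : (Fin k → ℝ) → Fin k} {Ω : Type*} [MeasurableSpace Ω] {P : Measure Ω}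
  [IsProbabilityMeasure P] {X : Fin k → ℕ → Ω → ℝ}

lemma deltaMin_mul_probError_le (hk : 2 ≤ k) (hb : ∀ i, i ≠ b → μ i < μ b)
    (hrule : IsKGRule σ rule) (hrecom : IsRecommendation recom) (hX : IsRewardModel P μ σ X)
    (t : ℕ) :
    deltaMin μ * probError P σ rule recom X b t ≤ simpleRegret P μ σ rule recom X b t := by
  obtain ⟨hδ, hδ'⟩ := deltaMin_pos_and_le hk hb
  have hJ := measurable_recommended (σ := σ) hrule.measurable hrecom.measurable hX.measurable t
  set S := {ω | recommended σ rule recom (fun i s => X i s ω) t ≠ b} with hS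
  have hSm : MeasurableSet S := hJ (measurableSet_singleton b).compl
  have h1 : deltaMin μ * probError P σ rule recom X b t =
      ∫ ω, S.indicator (fun _ => deltaMin μ) ω ∂P := by
    rw [integral_indicator_const _ hSm, smul_eq_mul, mul_comm]
    rfl
  rw [h1, simpleRegret]
  refine integral_mono ((integrable_const _).indicator hSm) ?_ fun ω => ?_
  · refine Integrable.of_bound (C := ∑ i, |μ b - μ i|)
      ((measurable_of_finite fun i => μ b - μ i).comp hJ).aestronglyMeasurable
      (ae_of_all _ fun ω => ?_)
    exact Finset.single_le_sum (f := fun i => |μ b - μ i|) (fun i _ => abs_nonneg _)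
      (Finset.mem_univ (recommended σ rule recom (fun i s => X i s ω) t))
  · by_cases h : ω ∈ S
    · rw [Set.indicator_of_mem h]
      exact hδ' _ _ (hb _ h)
    · rw [Set.indicator_of_notMem h]
      rw [hS, Set.mem_ofPred_eq, not_not] at h
      simp [h]

lemma eventually_mul_pow_add_le (A B : ℝ) {c : ℝ} (hc : 0 < c) (n : ℕ) :
    ∀ᶠ y : ℝ in atTop, A * y ^ n + B ≤ c * y ^ (n + 1) := by
  filter_upwards [eventually_ge_atTop 1, eventually_ge_atTop ((|A| + |B|) / c)] with y h1 h2
  rw [div_le_iff₀ hc] at h2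
  have h3 : (1 : ℝ) ≤ y ^ n := one_le_pow₀ h1
  have h4 := mul_le_mul_of_nonneg_right h2 (zero_le_one.trans h3)
  have h5 := mul_le_mul_of_nonneg_right (le_abs_self A) (zero_le_one.trans h3)
  have h6 := mul_le_mul_of_nonneg_left h3 (abs_nonneg B)
  have h7 := le_abs_self B
  calc A * y ^ n + B ≤ (|A| + |B|) * y ^ n := by linarith
    _ ≤ y * c * y ^ n := h4
    _ = c * y ^ (n + 1) := by ring

lemma le_of_exponents {B C E W e : ℝ} (hC : 0 < C) (hB : B ≤ C * Real.exp (-E))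
    (hW : 1 / 4 * Real.exp (-W) ≤ e) (h : W + Real.log (4 * C) ≤ E) : B ≤ e := by
  refine hB.trans (le_trans ?_ hW)
  calc C * Real.exp (-E) ≤ C * Real.exp (-(W + Real.log (4 * C))) := by gcongr
    _ = 1 / 4 * Real.exp (-W) := by
      rw [neg_add, Real.exp_add, Real.exp_neg (Real.log _), Real.exp_log (by positivity)]
      field_simp

lemma half_add_two_sqrt_le {V a t : ℝ} (ha : 0 ≤ a) (ht : 1 ≤ t) (hV : V ≤ a ^ 2 * t) :
    V / 2 + 2 * Real.sqrt V ≤ (a ^ 2 / 2 + 2 * a) * t := by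
  have h1 : Real.sqrt V ≤ a * t := by
    refine Real.sqrt_le_iff.2 ⟨by positivity, hV.trans ?_⟩
    rw [mul_pow]
    have : t ≤ t ^ 2 := by nlinarith
    gcongr
  linarith

lemma eventually_bounds_of_three_le (hk : 3 ≤ k) (hσ : ∀ i, 0 < σ i)
    (hb : ∀ i, i ≠ b → μ i < μ b) (hrule : IsKGRule σ rule) (hrecom : IsRecommendation recom)
    (hX : IsRewardModel P μ σ X) :
    ∃ K : ℝ, 0 < K ∧ ∀ᶠ t : ℕ in atTop,
      peLowerBound μ σ b t ≤ probError P σ rule recom X b t ∧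
      1 / 4 * Real.exp (-(K * t)) ≤ probError P σ rule recom X b t := by
  have hk2 : 2 ≤ k := by omega
  obtain ⟨a, a', haa, hab, hpair⟩ := exists_min_pair (μ := μ) hk2 hσ b
  set lam := |μ a - μ a'| / (σ a + σ a') with hlam
  have hlam0 : 0 ≤ lam := by have := hσ a; have := hσ a'; positivity
  obtain ⟨j, hj, hrate⟩ := exists_rate_lt hk hσ hb hlam0 hpair
  have hE := tendsto_tailExponent_div hk2 hσ hb hj
  set R := deltaMin μ ^ 2 * rho μ σ b j / (8 * σ j ^ 2 * sumRho μ σ b) +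
    (μ b - μ j - deltaMin μ / 2) ^ 2 / (2 * σ b ^ 2 * sumRho μ σ b)
  set d := R - lam ^ 2 / 2 with hd
  have hd0 : 0 < d := sub_pos.2 hrate
  obtain ⟨C₁, T, hC₁, hT⟩ := exists_le_probError_of_pair hk2 hσ hrule hX hrecom haa hab hd0
  rw [← hlam] at hT
  obtain ⟨C₂, hC₂, hB⟩ := exists_peLowerBound_le hk2 hσ hb hj
  set α := Real.sqrt (lam ^ 2 + d + C₁) with hα
  have hα0 : 0 ≤ α := Real.sqrt_nonneg _
  have hα2 : α ^ 2 = lam ^ 2 + d + C₁ := Real.sq_sqrt (by positivity)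
  refine ⟨α ^ 2 / 2 + 2 * α, by rw [hα2]; positivity, ?_⟩
  have hcast := tendsto_natCast_atTop_atTop (R := ℝ)
  filter_upwards [eventually_ge_atTop T, eventually_ge_atTop 1, hcast.eventually hB,
    hcast.eventually (hE.eventually_const_le (show R - d / 4 < R by linarith)),
    (Real.tendsto_sqrt_atTop.comp hcast).eventually (eventually_mul_pow_add_le (2 * α)
      (C₁ / 2 + Real.log (4 * C₂)) (show 0 < d / 4 by positivity) 1)] with t htT ht1 hBt hEt hyt
  have ht1' : (1 : ℝ) ≤ t := by exact_mod_cast ht1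
  have ht0 : (0 : ℝ) < t := by linarith
  have hlow := hT t htT _ rfl
  set V := (lam ^ 2 + d) * t + C₁ with hV
  have hVα : V ≤ α ^ 2 * t := by rw [hα2, hV]; nlinarith
  constructor
  · refine le_of_exponents hC₂ hBt hlow ?_
    rw [le_div_iff₀ ht0] at hEt
    have hsq : Real.sqrt V ≤ α * Real.sqrt t := by
      refine Real.sqrt_le_iff.2 ⟨by positivity, ?_⟩
      rw [mul_pow, Real.sq_sqrt ht0.le]
      exact hVα
    simp only [Function.comp_apply] at hyt
    rw [Real.sq_sqrt ht0.le, pow_one] at hyt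
    have h1 : R = lam ^ 2 / 2 + d := by rw [hd]; ring
    rw [h1] at hEt
    have h2 : V / 2 = (lam ^ 2 / 2 + d / 2) * t + C₁ / 2 := by rw [hV]; ring
    nlinarith
  · refine le_trans ?_ hlow
    gcongr
    exact half_add_two_sqrt_le hα0 ht1' hVα

lemma eventually_bounds_of_two (hk : k = 2) (hσ : ∀ i, 0 < σ i)
    (hb : ∀ i, i ≠ b → μ i < μ b) (hrule : IsKGRule σ rule) (hrecom : IsRecommendation recom)
    (hX : IsRewardModel P μ σ X) :
    ∃ K : ℝ, 0 < K ∧ ∀ᶠ t : ℕ in atTop,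
      peLowerBound μ σ b t ≤ probError P σ rule recom X b t ∧
      1 / 4 * Real.exp (-(K * t)) ≤ probError P σ rule recom X b t := by
  have hk2 : 2 ≤ k := hk.ge
  obtain ⟨j, hj, -⟩ := exists_maxOther_eq hk2 μ b
  have htwo : ∀ i, i = b ∨ i = j := by
    subst hk
    intro i
    omega
  obtain ⟨c, hc, hE⟩ := exists_le_tailExponent_of_two hk2 hσ hb hj.symm htwo
  obtain ⟨C₁, T, hC₁, hT⟩ := exists_le_probError_of_two hk2 hσ hrule hX hrecom hj.symm htwo
  obtain ⟨C₂, hC₂, hB⟩ := exists_peLowerBound_le hk2 hσ hb hj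
  set lam := |μ b - μ j| / (σ b + σ j) with hlam
  have hlam0 : 0 ≤ lam := by have := hσ b; have := hσ j; positivity
  refine ⟨(lam + C₁) ^ 2 / 2 + 2 * (lam + C₁), by positivity, ?_⟩
  have hcast := tendsto_natCast_atTop_atTop (R := ℝ)
  filter_upwards [eventually_ge_atTop T, eventually_ge_atTop 1, hcast.eventually hB,
    hcast.eventually hE,
    ((tendsto_rpow_atTop (show (0 : ℝ) < 1 / 4 by norm_num)).comp hcast).eventually
      (eventually_mul_pow_add_le (lam * C₁ + 2 * lam)
      (C₁ ^ 2 / 2 + 2 * C₁ + Real.log (4 * C₂)) hc 2)] with t htT ht1 hBt hEt hyt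
  have ht1' : (1 : ℝ) ≤ t := by exact_mod_cast ht1
  have ht0 : (0 : ℝ) < t := by linarith
  have hlow := hT t htT _ rfl
  set y := (t : ℝ) ^ (1 / 4 : ℝ) with hy
  have hy0 : 0 < y := Real.rpow_pos_of_pos ht0 _
  have hy4 : y ^ 4 = t := by
    rw [hy, ← Real.rpow_natCast, ← Real.rpow_mul ht0.le]
    norm_num
  have hysq : Real.sqrt t = y ^ 2 := by
    rw [← hy4, show y ^ 4 = (y ^ 2) ^ 2 by ring, Real.sqrt_sq (by positivity)]
  have hyinv : (t : ℝ) ^ (-(1 / 4) : ℝ) = y⁻¹ := Real.rpow_neg ht0.le _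
  set V := (lam + C₁ / Real.sqrt t) ^ 2 * t with hV
  constructor
  · refine le_of_exponents hC₂ hBt hlow ?_
    rw [hyinv, ← hy4] at hEt
    simp only [Function.comp_apply, ← hy] at hyt
    have hsq : Real.sqrt V = lam * y ^ 2 + C₁ := by
      have h1 : V = (lam * y ^ 2 + C₁) ^ 2 := by
        rw [hV, hysq, ← hy4]
        field_simp
      rw [h1, Real.sqrt_sq (by positivity)]
    have h2 : V / 2 = lam ^ 2 * y ^ 4 / 2 + lam * C₁ * y ^ 2 + C₁ ^ 2 / 2 := by
      rw [hV, hysq, ← hy4]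
      field_simp
      ring
    have h3 : y ^ 4 * y⁻¹ = y ^ (2 + 1) := by field_simp
    rw [h3, hy4] at hEt
    rw [hsq, h2, hy4]
    linarith
  · refine le_trans ?_ hlow
    gcongr
    refine half_add_two_sqrt_le (by positivity) ht1' ?_
    have h1 : C₁ / Real.sqrt t ≤ C₁ := div_le_self hC₁.le (Real.one_le_sqrt.2 ht1')
    rw [hV]
    gcongr

end Final

end KnowledgeGradient

theorem proposition3 {k : ℕ} (hk : 2 ≤ k) (μ σ : Fin k → ℝ) (hσ : ∀ i, 0 < σ i)
    (b : Fin k) (hb : ∀ i, i ≠ b → μ i < μ b)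
    (rule : KnowledgeGradient.Knowledge k → Fin k) (hrule : KnowledgeGradient.IsKGRule σ rule)
    (recom : (Fin k → ℝ) → Fin k) (hrecom : KnowledgeGradient.IsRecommendation recom)
    {Ω : Type*} [MeasurableSpace Ω] (P : Measure Ω) [IsProbabilityMeasure P]
    (X : Fin k → ℕ → Ω → ℝ) (hX : KnowledgeGradient.IsRewardModel P μ σ X) :
    ∃ T : ℕ,
      (∀ t : ℕ, T < t →
        KnowledgeGradient.peLowerBound μ σ b t ≤
            KnowledgeGradient.probError P σ rule recom X b t ∧
        KnowledgeGradient.deltaMin μ * KnowledgeGradient.peLowerBound μ σ b t ≤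
            KnowledgeGradient.simpleRegret P μ σ rule recom X b t) ∧
      ∃ c C : ℝ, 0 < c ∧ 0 < C ∧ ∀ t : ℕ, T < t →
        c * Real.exp (-(C * t)) ≤ KnowledgeGradient.probError P σ rule recom X b t ∧
        c * Real.exp (-(C * t)) ≤ KnowledgeGradient.simpleRegret P μ σ rule recom X b t := by
  obtain ⟨K, hK, h⟩ : ∃ K : ℝ, 0 < K ∧ ∀ᶠ t : ℕ in Filter.atTop,
      KnowledgeGradient.peLowerBound μ σ b t ≤
        KnowledgeGradient.probError P σ rule recom X b t ∧
      1 / 4 * Real.exp (-(K * t)) ≤ KnowledgeGradient.probError P σ rule recom X b t := by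
    rcases hk.eq_or_lt with h | h
    · exact KnowledgeGradient.eventually_bounds_of_two h.symm hσ hb hrule hrecom hX
    · exact KnowledgeGradient.eventually_bounds_of_three_le h hσ hb hrule hrecom hX
  obtain ⟨T, hT⟩ := Filter.eventually_atTop.1 h
  have hδ := (KnowledgeGradient.deltaMin_pos_and_le hk hb).1
  have hreg := KnowledgeGradient.deltaMin_mul_probError_le hk hb hrule hrecom hX
  refine ⟨T, fun t ht => ⟨(hT t ht.le).1, ?_⟩, min 1 (KnowledgeGradient.deltaMin μ) * (1 / 4), K,
    by positivity, hK, fun t ht => ?_⟩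
  · exact (mul_le_mul_of_nonneg_left (hT t ht.le).1 hδ.le).trans (hreg t)
  · have h1 := (hT t ht.le).2
    have h0 : 0 ≤ 1 / 4 * Real.exp (-(K * t)) := by positivity
    rw [mul_assoc]
    constructor
    · exact (mul_le_of_le_one_left h0 (min_le_left _ _)).trans h1
    · exact (mul_le_mul (min_le_right _ _) h1 h0 hδ.le).trans (hreg t)
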